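/- Let $\alpha_\mu>0$, $\alpha_w>3$, $t>0$. In the two-variable BGe model, a mean vector $\mu\in\mathbb R^2$ and a positive definite $2\times2$ precision matrix $W$ have the Normal–Wishart prior with density (with respect to Lebesgue measure in $\mu_1,\mu_2,W_{11},W_{12},W_{22}$) $$\frac{|W|^{(\alpha_w-3)/2}}{Z}\exp\left\{-\tfrac12\mathrm{Tr}(TW)\right\}\cdot\frac{\alpha_\mu|W|^{1/2}}{2\pi}\exp\left\{-\tfrac12\alpha_\mu(\mu-\nu)^TW(\mu-\nu)\right\},\qquad \nu=0,\quad T=tI_2,$$ where $Z=2^{\alpha_w}\,\pi^{1/2}\,\Gamma(\tfrac{\alpha_w}2)\Gamma(\tfrac{\alpha_w-1}2)\,|T|^{-\alpha_w/2}$. For data $\boldsymbol X=(x_1,\dots,x_N)\in(\mathbb R^2)^N$, the marginal likelihood $P(\boldsymbol X\mid\mathcal G)$ of a graph with an edge ($\mathcal G_1: X_1\to X_2$, or $\mathcal G_2: X_2\to X_1$) is the integral of the likelihood $\prod_k\mathcal N(x_k;\mu,W^{-1})$ against this prior. In the empty graph $\mathcal G_0$, $X_1$ and $X_2$ are independent with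 $X_i\sim\mathcal N(\mu_i,v_i)$; the pairs $(\mu_1,v_1)$ and $(\mu_2,v_2)$ are independent under the prior, and $(\mu_i,v_i)$ has the law of $(\mu_i,(W^{-1})_{ii})$ under the Normal–Wishart prior; $P(\boldsymbol X\mid\mathcal G_0)$ is the corresponding integral of the likelihood. Let the three graphs have prior probabilities $P(\mathcal G)\ge0$ with sum $1$ and $P(\mathcal G_0),P(\mathcal G_1)>0$, and let $P(\mathcal G\mid\boldsymbol X)\propto P(\boldsymbol X\mid\mathcal G)P(\mathcal G)$ be the posterior probabilities. Let $P$ be any probability law of $(X_1,X_2)$ on $\mathbb R^2$, not necessarily Gaussian or continuous, with finite second moments and covariance matrix $\Sigma$ such that $\Sigma_{11}\Sigma_{22}-\Sigma_{12}^2\neq0$. For $N$ independent samples $\boldsymbol X$ from $P$, the log posterior ratio $\log\frac{P(\mathcal G_1\mid\boldsymbol X)}{P(\mathcal G_0\mid\boldsymbol X)}$ is integrable for every $N$, and $$r_{10}=\frac1N\,\mathbb E\left[\log\frac{P(\mathcal G_1\mid\boldsymbol X)}{P(\mathcal G_0\mid\boldsymbol X)}\right]\quad\text{satisfies}\quad\lim_{N\to\infty}r_{10}=\frac12\log\left(\frac{\Sigma_{11}\Sigma_{22}}{\Sigma_{11}\Sigma_{22}-\Sigma_{12}^2}\right).$$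 -/

import Mathlib

open MeasureTheory ProbabilityTheory

noncomputable section

namespace BGe

/-- The multivariate gamma function
`Γ_n(x) = π^{n(n-1)/4} ∏_{j=1}^n Γ(x + (1 - j)/2)`. -/
def multivariateGamma (n : ℕ) (x : ℝ) : ℝ :=
  Real.pi ^ ((n : ℝ) * ((n : ℝ) - 1) / 4) *
    ∏ j ∈ Finset.Icc 1 n, Real.Gamma (x + (1 - (j : ℝ)) / 2)

/-- The normalizing constant of the Wishart density. -/
def wishartConst {n : ℕ} (T : Matrix (Fin n) (Fin n) ℝ) (αw : ℝ) : ℝ :=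
  (2 : ℝ) ^ (αw * (n : ℝ) / 2) * multivariateGamma n (αw / 2) / T.det ^ (αw / 2)

/-- The density of the Wishart distribution `𝒲_n(T⁻¹, αw)`, supported on the positive definite
matrices. -/
def wishartDensity {n : ℕ} (T : Matrix (Fin n) (Fin n) ℝ) (αw : ℝ) :
    Matrix (Fin n) (Fin n) ℝ → ℝ :=
  Set.indicator {W | W.PosDef} fun W =>
    W.det ^ ((αw - (n : ℝ) - 1) / 2) / wishartConst T αw *
      Real.exp (-(1 / 2) * (T * W).trace)

/-- The density of `μ` given `W` under the normal distribution with mean `ν` and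
precision matrix `αμ W`. -/
def meanDensity {n : ℕ} (ν : Fin n → ℝ) (αμ : ℝ) (W : Matrix (Fin n) (Fin n) ℝ)
    (μ : Fin n → ℝ) : ℝ :=
  αμ ^ ((n : ℝ) / 2) * W.det ^ (1 / 2 : ℝ) / (2 * Real.pi) ^ ((n : ℝ) / 2) *
    Real.exp (-(1 / 2) * (Matrix.vecMulVec (μ - ν) (μ - ν) * (αμ • W)).trace)

/-- The density at `x` of the multivariate normal distribution with mean `μ` and precision
matrix `W`. -/
def mvnDensity {n : ℕ} (μ : Fin n → ℝ) (W : Matrix (Fin n) (Fin n) ℝ) (x : Fin n → ℝ) : ℝ :=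
  W.det ^ (1 / 2 : ℝ) / (2 * Real.pi) ^ ((n : ℝ) / 2) *
    Real.exp (-(1 / 2) * ((x - μ) ⬝ᵥ (W.mulVec (x - μ))))

/-- Parameters of the bivariate Gaussian model: the mean vector `μ` and the three free entries
`(W₁₁, W₁₂, W₂₂)` of the symmetric precision matrix. -/
abbrev Param : Type := (Fin 2 → ℝ) × (ℝ × ℝ × ℝ)

/-- The mean vector of a parameter. -/
def Param.mean (θ : Param) : Fin 2 → ℝ := θ.1

/-- The precision matrix of a parameter. -/
def Param.prec (θ : Param) : Matrix (Fin 2) (Fin 2) ℝ :=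
  !![θ.2.1, θ.2.2.1; θ.2.2.1, θ.2.2.2]

/-- The Normal–Wishart prior on `(μ, W)` with `ν = 0` and `T = t I₂`: its density with respect to
Lebesgue measure in the coordinates `(μ₁, μ₂, W₁₁, W₁₂, W₂₂)` is the Wishart density of `W` times
the normal density of `μ` given `W`. -/
def prior (αμ αw t : ℝ) : Measure Param :=
  volume.withDensity fun θ => ENNReal.ofReal
    (wishartDensity (t • (1 : Matrix (Fin 2) (Fin 2) ℝ)) αw θ.prec *
      meanDensity 0 αμ θ.prec θ.mean)

/-- The parameters (mean and variance) of the `i`-th variable alone under the bivariate Gaussian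
with parameter `θ`. -/
def Param.marginal (i : Fin 2) (θ : Param) : ℝ × ℝ := (θ.mean i, (θ.prec)⁻¹ i i)

/-- The directed acyclic graphs on two nodes. -/
inductive DAG : Type
  /-- no edge (`𝒢₀`) -/
  | empty : DAG
  /-- the graph `X₁ → X₂` (`𝒢₁`) -/
  | oneToTwo : DAG
  /-- the graph `X₂ → X₁` -/
  | twoToOne : DAG

/-- The BGe marginal likelihood `P(X ∣ 𝒢) = ∫ P(X ∣ Θ, 𝒢) P(Θ ∣ 𝒢) dΘ` of a data set of `N` rows.

* In a graph with an edge the model is an unrestricted bivariate Gaussian, and `(μ, W)` has the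
  Normal–Wishart prior.
* In the empty graph the two variables are independent Gaussians. By global parameter
  independence their parameters are independent under the prior, and by parameter modularity the
  parameters of each of them have the distribution they have under the Normal–Wishart prior. -/
def marginalLikelihood (αμ αw t : ℝ) {N : ℕ} (x : Fin N → Fin 2 → ℝ) : DAG → ℝ
  | .empty =>
      ∫ η : (ℝ × ℝ) × (ℝ × ℝ),
        ∏ k, (gaussianPDFReal η.1.1 η.1.2.toNNReal (x k 0) *
          gaussianPDFReal η.2.1 η.2.2.toNNReal (x k 1))
        ∂(((prior αμ αw t).map (Param.marginal 0)).prod ((prior αμ αw t).map (Param.marginal 1)))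
  | .oneToTwo => ∫ θ, ∏ k, mvnDensity θ.mean θ.prec (x k) ∂(prior αμ αw t)
  | .twoToOne => ∫ θ, ∏ k, mvnDensity θ.mean θ.prec (x k) ∂(prior αμ αw t)

/-- The posterior probability `P(𝒢 ∣ X)` for the prior probabilities `p` of the graphs. -/
def posterior (αμ αw t : ℝ) (p : DAG → ℝ) {N : ℕ} (x : Fin N → Fin 2 → ℝ) (G : DAG) : ℝ :=
  p G * marginalLikelihood αμ αw t x G /
    (p .empty * marginalLikelihood αμ αw t x .empty +
      p .oneToTwo * marginalLikelihood αμ αw t x .oneToTwo +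
      p .twoToOne * marginalLikelihood αμ αw t x .twoToOne)

/-- The log posterior ratio of `X₁ → X₂` versus the empty graph. -/
def logPosteriorRatio (αμ αw t : ℝ) (p : DAG → ℝ) {N : ℕ} (x : Fin N → Fin 2 → ℝ) : ℝ :=
  Real.log (posterior αμ αw t p x .oneToTwo / posterior αμ αw t p x .empty)

/-- The expected log posterior ratio per sample, `r₁₀`, for `N` independent samples from `P`. -/
def r10 (αμ αw t : ℝ) (p : DAG → ℝ) (P : Measure (Fin 2 → ℝ)) (N : ℕ) : ℝ :=
  1 / (N : ℝ) * ∫ x, logPosteriorRatio αμ αw t p x ∂(Measure.pi fun _ : Fin N => P)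

/-- The covariance matrix of the two coordinates under `P`. -/
def covMatrix (P : Measure (Fin 2 → ℝ)) : Matrix (Fin 2) (Fin 2) ℝ :=
  Matrix.of fun i j => covariance (fun x => x i) (fun x => x j) P

end BGe

end

/-! Let S be the scatter matrix with entries `scatter`, let A, B be the diagonal entries of tI + S
and Δ its determinant. Conjugacy makes both marginal likelihoods explicit, and the log posterior
ratio collapses to C + log Γ((αw+N)/2) − log Γ((αw+N−1)/2) + (αw+N−1)/2 · (log A + log B) − (αw+N)/2
· log Δ (`exists_logPosteriorRatio_eq`). The Gamma quotient contributes O(log N). As S/N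
approximates Σ, division by N leaves ½ (log Σ₁₁ + log Σ₂₂ − log det Σ), provided that the expected
values of log A, log B and log Δ, centred by log N, log N and 2 log N, converge.

The closed forms come from the coordinates of the regression of X₂ on X₁ (`Param.ofRegression`): the
shear has Jacobian 1 and separates the prior and the likelihood into Gaussian and Gamma integrals.
Working with lower integrals makes integrability automatic.

The convergence of the expected logarithms (`tendsto_integral_log_scatter`,
`tendsto_integral_log_det`) has to use second moments only. The upper bound is concavity: log and
log det lie below their tangents at NΣ, and the expectation of S is explicit. For the lower bound,
discarding large observations can only decrease the scatter matrix (`weighted_det_le`). Truncated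
moments have finite variance, so Chebyshev bounds the probability of a bad event by O(1/N). There
the deterministic bounds A, B ≥ t and Δ ≥ t² cost only O(log N), so the loss vanishes
(`eventually_lt_integral_of_measureReal_lt`). -/

noncomputable section

namespace BGe

open scoped ENNReal

/-! ### Algebra of the scatter matrix -/

/-- The entry of the posterior scatter matrix of the Normal–Wishart model contributed by
the data columns `f` and `g`, when the prior mean is zero. -/
def scatter (α : ℝ) {N : ℕ} (f g : Fin N → ℝ) : ℝ :=
  ∑ k, f k * g k - (∑ k, f k) * (∑ k, g k) / (α + N)

/-- Completing the square in `m`: the prior acts as `α` extra observations at 0, and the scatter is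
the minimum over the centre. -/
theorem sum_sq_sub_add_eq_scatter {α : ℝ} (hα : 0 < α) {N : ℕ} (y : Fin N → ℝ) (m : ℝ) :
    α * m ^ 2 + ∑ k, (y k - m) ^ 2 =
      (α + N) * (m - (∑ k, y k) / (α + N)) ^ 2 + scatter α y y := by
  have hN : α + N ≠ 0 := by positivity
  have h : ∑ k, (y k - m) ^ 2 = ∑ k, y k * y k - 2 * m * ∑ k, y k + N * m ^ 2 := by
    rw [Finset.mul_sum, ← Finset.sum_sub_distrib]
    have : (N : ℝ) * m ^ 2 = ∑ _k : Fin N, m ^ 2 := by simp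
    rw [this, ← Finset.sum_add_distrib]
    exact Finset.sum_congr rfl fun k _ => by ring
  rw [h, scatter]
  field_simp
  ring

theorem scatter_nonneg {α : ℝ} (hα : 0 < α) {N : ℕ} (y : Fin N → ℝ) : 0 ≤ scatter α y y := by
  have h := sum_sq_sub_add_eq_scatter hα y ((∑ k, y k) / (α + N))
  simp only [sub_self, ne_eq, OfNat.ofNat_ne_zero, not_false_eq_true, zero_pow, mul_zero,
    zero_add] at h
  rw [← h]
  positivity

theorem scatter_add_mul (α : ℝ) {N : ℕ} (f g : Fin N → ℝ) (u v : ℝ) :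
    scatter α (fun k => u * f k + v * g k) (fun k => u * f k + v * g k) =
      u ^ 2 * scatter α f f + 2 * u * v * scatter α f g + v ^ 2 * scatter α g g := by
  have h1 : ∑ k, (u * f k + v * g k) = u * ∑ k, f k + v * ∑ k, g k := by
    rw [Finset.sum_add_distrib, Finset.mul_sum, Finset.mul_sum]
  have h2 : ∑ k, (u * f k + v * g k) * (u * f k + v * g k) =
      u ^ 2 * ∑ k, f k * f k + 2 * u * v * ∑ k, f k * g k + v ^ 2 * ∑ k, g k * g k := by
    simp only [Finset.mul_sum, ← Finset.sum_add_distrib]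
    exact Finset.sum_congr rfl fun k _ => by ring
  rw [scatter, h1, h2, scatter, scatter, scatter]
  ring

/-! ### Gaussian, Gamma and Wishart integrals -/

theorem lintegral_gaussian_shift {b : ℝ} (hb : 0 < b) (m K : ℝ) :
    ∫⁻ x : ℝ, ENNReal.ofReal (Real.exp (-b * (x - m) ^ 2 + K)) =
      ENNReal.ofReal (√(Real.pi / b) * Real.exp K) := by
  rw [lintegral_sub_right_eq_self
    (fun x : ℝ => ENNReal.ofReal (Real.exp (-b * x ^ 2 + K))) m]
  simp_rw [Real.exp_add]
  rw [← ofReal_integral_eq_lintegral_ofReal ((integrable_exp_neg_mul_sq hb).mul_const _)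
    (Filter.Eventually.of_forall fun x => by positivity), integral_mul_const, integral_gaussian]

theorem lintegral_mean {α : ℝ} (hα : 0 < α) {l : ℝ} (hl : 0 < l) {N : ℕ} (y : Fin N → ℝ) :
    ∫⁻ m : ℝ, ENNReal.ofReal
        (Real.exp (-(1 / 2) * (l * (α * m ^ 2 + ∑ k, (y k - m) ^ 2)))) =
      ENNReal.ofReal (√(2 * Real.pi / ((α + N) * l)) *
        Real.exp (-(1 / 2) * (l * scatter α y y))) := by
  have hb : 0 < (α + N) * l / 2 := by positivity
  have h : ∀ m : ℝ, -(1 / 2) * (l * (α * m ^ 2 + ∑ k, (y k - m) ^ 2)) =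
      -((α + N) * l / 2) * (m - (∑ k, y k) / (α + N)) ^ 2 +
        -(1 / 2) * (l * scatter α y y) := by
    intro m
    rw [sum_sq_sub_add_eq_scatter hα]
    ring
  simp_rw [h]
  rw [lintegral_gaussian_shift hb]
  congr 3
  field_simp

theorem lintegral_gamma {a r : ℝ} (ha : 0 < a) (hr : 0 < r) :
    ∫⁻ s in Set.Ioi (0 : ℝ), ENNReal.ofReal (s ^ (a - 1) * Real.exp (-(r * s))) =
      ENNReal.ofReal ((1 / r) ^ a * Real.Gamma a) := by
  rw [← Real.integral_rpow_mul_exp_neg_mul_Ioi ha hr, ofReal_integral_eq_lintegral_ofReal]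
  · have h := integrableOn_rpow_mul_exp_neg_mul_rpow (s := a - 1) (p := 1) (b := r)
      (by linarith) one_pos hr
    refine h.congr_fun (fun s _ => ?_) measurableSet_Ioi
    simp
  · refine (ae_restrict_iff' measurableSet_Ioi).2 (Filter.Eventually.of_forall fun s hs => ?_)
    have : (0 : ℝ) < s := hs
    positivity

/-- The normalising integral of a (weighted) bivariate Wishart density, in the coordinates
`W₂₂ = c`, `W₁₂ = b`, `W₁₁ = s + b ^ 2 / c`. -/
theorem lintegral_wishart {p q A t₁ t₁₂ t₂ : ℝ} (hp : 0 < p) (hq : 0 < q) (hA : 0 < A)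
    (ht₁ : 0 < t₁) (ht : 0 < t₁ * t₂ - t₁₂ ^ 2) :
    ∫⁻ c in Set.Ioi (0 : ℝ), ∫⁻ b : ℝ, ∫⁻ s in Set.Ioi (0 : ℝ),
        ENNReal.ofReal (c ^ (p - 3 / 2) * s ^ (q - 1) *
          Real.exp (-(1 / 2) * (A * s + t₁ * (b ^ 2 / c) + 2 * t₁₂ * b + t₂ * c))) =
      ENNReal.ofReal ((2 / A) ^ q * Real.Gamma q * √(2 * Real.pi / t₁) *
        ((2 * t₁ / (t₁ * t₂ - t₁₂ ^ 2)) ^ p * Real.Gamma p)) := by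
  have hGq := Real.Gamma_pos_of_pos hq
  -- The `s`-integral is a Gamma integral. In `b` the exponent is a square centred at `-(t₁₂ * c /
  -- t₁)`; its Gaussian integral carries a factor `√c`, which turns the power `p - 3 / 2` into `p -
  -- 1` and leaves a Gamma integral in `c`.
  have hinner : ∀ c ∈ Set.Ioi (0 : ℝ), ∫⁻ b : ℝ, ∫⁻ s in Set.Ioi (0 : ℝ),
        ENNReal.ofReal (c ^ (p - 3 / 2) * s ^ (q - 1) *
          Real.exp (-(1 / 2) * (A * s + t₁ * (b ^ 2 / c) + 2 * t₁₂ * b + t₂ * c))) =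
      ENNReal.ofReal ((2 / A) ^ q * Real.Gamma q * √(2 * Real.pi / t₁)) *
        ENNReal.ofReal (c ^ (p - 1) *
          Real.exp (-((t₁ * t₂ - t₁₂ ^ 2) / (2 * t₁) * c))) := by
    intro c hc
    have hc : 0 < c := hc
    have hs : ∀ b : ℝ, ∫⁻ s in Set.Ioi (0 : ℝ),
        ENNReal.ofReal (c ^ (p - 3 / 2) * s ^ (q - 1) *
          Real.exp (-(1 / 2) * (A * s + t₁ * (b ^ 2 / c) + 2 * t₁₂ * b + t₂ * c))) =
        ENNReal.ofReal (c ^ (p - 3 / 2) * ((2 / A) ^ q * Real.Gamma q)) *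
          ENNReal.ofReal (Real.exp (-(t₁ / (2 * c)) * (b - (-(t₁₂ * c / t₁))) ^ 2 +
            -((t₁ * t₂ - t₁₂ ^ 2) / (2 * t₁) * c))) := by
      intro b
      have h1 : ∀ s : ℝ, ENNReal.ofReal (c ^ (p - 3 / 2) * s ^ (q - 1) *
          Real.exp (-(1 / 2) * (A * s + t₁ * (b ^ 2 / c) + 2 * t₁₂ * b + t₂ * c))) =
          ENNReal.ofReal (c ^ (p - 3 / 2) *
            Real.exp (-(t₁ / (2 * c)) * (b - (-(t₁₂ * c / t₁))) ^ 2 +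
              -((t₁ * t₂ - t₁₂ ^ 2) / (2 * t₁) * c))) *
            ENNReal.ofReal (s ^ (q - 1) * Real.exp (-(A / 2 * s))) := by
        intro s
        rw [← ENNReal.ofReal_mul (by positivity), mul_mul_mul_comm, ← Real.exp_add]
        congr 3
        field_simp
        ring
      simp_rw [h1]
      rw [lintegral_const_mul _ (by fun_prop), lintegral_gamma hq (by positivity),
        ← ENNReal.ofReal_mul (by positivity), ← ENNReal.ofReal_mul (by positivity)]
      congr 1
      have : 1 / (A / 2) = 2 / A := by field_simp
      rw [this]
      ring
    simp_rw [hs]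
    rw [lintegral_const_mul _ (by fun_prop), lintegral_gaussian_shift (by positivity),
      ← ENNReal.ofReal_mul (by positivity), ← ENNReal.ofReal_mul (by positivity)]
    congr 1
    have h2 : Real.pi / (t₁ / (2 * c)) = 2 * Real.pi / t₁ * c := by field_simp
    have h3 : c ^ (p - 1) = c ^ (p - 3 / 2) * √c := by
      rw [Real.sqrt_eq_rpow, ← Real.rpow_add hc]
      congr 1
      ring
    rw [h2, Real.sqrt_mul (by positivity), h3]
    ring
  rw [setLIntegral_congr_fun measurableSet_Ioi hinner, lintegral_const_mul _ (by fun_prop),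
    lintegral_gamma hp (by positivity), ← ENNReal.ofReal_mul (by positivity)]
  congr 4
  field_simp

/-! ### Integration against the prior in regression coordinates -/

theorem posDef_fin_two_iff (a b c : ℝ) :
    (!![a, b; b, c] : Matrix (Fin 2) (Fin 2) ℝ).PosDef ↔ 0 < c ∧ 0 < a * c - b ^ 2 := by
  constructor
  · intro h
    have h1 := h.det_pos
    have h2 := h.diag_pos (i := 1)
    rw [Matrix.det_fin_two] at h1
    simp at h1 h2
    exact ⟨h2, by nlinarith⟩
  · rintro ⟨hc, hd⟩
    refine Matrix.PosDef.of_dotProduct_mulVec_pos ?_ ?_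
    · ext i j
      fin_cases i <;> fin_cases j <;> simp
    · intro x hx
      have h : star x ⬝ᵥ (!![a, b; b, c] : Matrix (Fin 2) (Fin 2) ℝ).mulVec x =
          (a * c - b ^ 2) / c * x 0 ^ 2 + c * (x 1 + b / c * x 0) ^ 2 := by
        simp [Matrix.mulVec, dotProduct, Fin.sum_univ_two]
        field_simp
        ring
      rw [h]
      by_cases h0 : x 0 = 0
      · have h1 : x 1 ≠ 0 := by
          intro h1
          apply hx
          ext i
          fin_cases i <;> simp [h0, h1]
        rw [h0]
        simp only [ne_eq, OfNat.ofNat_ne_zero, not_false_eq_true, zero_pow, mul_zero, add_zero,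
          zero_add]
        positivity
      · have : 0 < (a * c - b ^ 2) / c * x 0 ^ 2 := by positivity
        positivity

/-- The order of integration matters: `a` is integrated inside `b` and `c`, and `m₁` inside `m₀`, so
that the passage to regression coordinates only translates one variable by a function of the outer
ones. -/
theorem lintegral_param {g : Param → ℝ≥0∞} (hg : Measurable g) :
    ∫⁻ θ, g θ = ∫⁻ c : ℝ, ∫⁻ b : ℝ, ∫⁻ a : ℝ, ∫⁻ m₀ : ℝ, ∫⁻ m₁ : ℝ,
      g (![m₀, m₁], (a, b, c)) := by
  have hmean : ∀ w : ℝ × ℝ × ℝ, ∫⁻ m : Fin 2 → ℝ, g (m, w) =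
      ∫⁻ m₀ : ℝ, ∫⁻ m₁ : ℝ, g (![m₀, m₁], w) := by
    intro w
    have h := (volume_preserving_finTwoArrow ℝ).symm.lintegral_comp
      (f := fun m : Fin 2 → ℝ => g (m, w)) (by fun_prop)
    rw [← h, Measure.volume_eq_prod, lintegral_prod]
    · rfl
    · exact ((hg.comp (measurable_id.prodMk measurable_const)).comp
        (MeasurableEquiv.measurable (MeasurableEquiv.finTwoArrow.symm))).aemeasurable
  have h1 : Measurable fun w : ℝ × ℝ × ℝ => ∫⁻ m : Fin 2 → ℝ, g (m, w) :=
    Measurable.lintegral_prod_left' hg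
  rw [Measure.volume_eq_prod, lintegral_prod_symm' _ hg, Measure.volume_eq_prod,
    lintegral_prod_symm' _ h1, Measure.volume_eq_prod,
    lintegral_prod_symm' _ (Measurable.lintegral_prod_left' h1)]
  simp_rw [hmean]

theorem posDef_prec_iff (θ : Param) :
    θ.prec.PosDef ↔ 0 < θ.2.2.2 ∧ 0 < θ.2.1 * θ.2.2.2 - θ.2.2.1 ^ 2 :=
  posDef_fin_two_iff _ _ _

/-- The parameter with `W₂₂ = c`, `W₁₂ = b`, `|W| = s c`, mean `m₀` of the first variable, and
`m₁` as intercept of the regression of the second variable on the first. -/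
def Param.ofRegression (c b s m₀ m₁ : ℝ) : Param :=
  (![m₀, m₁ - b / c * m₀], (s + b ^ 2 / c, b, c))

/-- Two translations suffice, `a = s + b ^ 2 / c` and a shift of the second mean by `b / c * m₀`, so
no Jacobian appears. Positive definiteness becomes `c > 0` and `s > 0`, and elsewhere `g` vanishes.
-/
theorem lintegral_ofRegression {g : Param → ℝ≥0∞} (hg : Measurable g)
    (hpd : ∀ θ : Param, ¬ θ.prec.PosDef → g θ = 0) :
    ∫⁻ θ, g θ = ∫⁻ c in Set.Ioi (0 : ℝ), ∫⁻ b : ℝ, ∫⁻ s in Set.Ioi (0 : ℝ),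
      ∫⁻ m₀ : ℝ, ∫⁻ m₁ : ℝ, g (Param.ofRegression c b s m₀ m₁) := by
  rw [lintegral_param hg, ← lintegral_indicator measurableSet_Ioi]
  refine lintegral_congr fun c => ?_
  by_cases hc : 0 < c
  · rw [Set.indicator_of_mem (show c ∈ Set.Ioi 0 from hc)]
    refine lintegral_congr fun b => ?_
    rw [← lintegral_add_right_eq_self _ (b ^ 2 / c), ← lintegral_indicator measurableSet_Ioi]
    refine lintegral_congr fun s => ?_
    by_cases hs : 0 < s
    · rw [Set.indicator_of_mem (show s ∈ Set.Ioi 0 from hs)]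
      refine lintegral_congr fun m₀ => ?_
      rw [← lintegral_sub_right_eq_self _ (b / c * m₀)]
      rfl
    · rw [Set.indicator_of_notMem (by simpa using hs)]
      refine (lintegral_congr fun m₀ => lintegral_congr fun m₁ => hpd _ ?_).trans (by simp)
      rw [posDef_prec_iff]
      rintro ⟨-, h⟩
      simp only at h
      have : (s + b ^ 2 / c) * c - b ^ 2 = s * c := by field_simp; ring
      rw [this] at h
      exact hs (pos_of_mul_pos_left h hc.le)
  · rw [Set.indicator_of_notMem (by simpa using hc)]
    refine (lintegral_congr fun b => lintegral_congr fun a => lintegral_congr fun m₀ =>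
      lintegral_congr fun m₁ => hpd _ ?_).trans (by simp)
    rw [posDef_prec_iff]
    exact fun h => hc h.1

/-- The density of the Normal–Wishart prior. -/
def priorDensity (αμ αw t : ℝ) (θ : Param) : ℝ :=
  wishartDensity (t • (1 : Matrix (Fin 2) (Fin 2) ℝ)) αw θ.prec * meanDensity 0 αμ θ.prec θ.mean

theorem measurable_priorDensity (αμ αw t : ℝ) : Measurable (priorDensity αμ αw t) := by
  have hset : MeasurableSet {θ : Param | θ.prec.PosDef} := by
    simp_rw [posDef_prec_iff]
    exact (measurableSet_lt (f := fun _ => (0 : ℝ)) (g := fun θ : Param => θ.2.2.2)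
      (by fun_prop) (by fun_prop)).inter (measurableSet_lt (f := fun _ => (0 : ℝ))
        (g := fun θ : Param => θ.2.1 * θ.2.2.2 - θ.2.2.1 ^ 2) (by fun_prop) (by fun_prop))
  have h : priorDensity αμ αw t = fun θ => Set.indicator {θ : Param | θ.prec.PosDef}
      (fun θ => θ.prec.det ^ ((αw - (2 : ℕ) - 1) / 2) /
        wishartConst (t • (1 : Matrix (Fin 2) (Fin 2) ℝ)) αw *
        Real.exp (-(1 / 2) * ((t • (1 : Matrix (Fin 2) (Fin 2) ℝ)) * θ.prec).trace)) θ *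
      meanDensity 0 αμ θ.prec θ.mean := by
    ext θ
    rfl
  rw [h]
  refine (Measurable.indicator ?_ hset).mul ?_
  · simp only [Param.prec, Matrix.det_fin_two_of, Matrix.trace_fin_two, Matrix.smul_mul, one_mul,
      Matrix.smul_apply, Matrix.of_apply, Matrix.cons_val', Matrix.cons_val_zero,
      Matrix.cons_val_one, Matrix.cons_val_fin_one]
    fun_prop
  · simp only [meanDensity, Param.prec, Param.mean, Matrix.det_fin_two_of, Matrix.trace_fin_two,
      Matrix.mul_apply, Fin.sum_univ_two, Matrix.vecMulVec_apply,
      Matrix.smul_apply, Matrix.of_apply, Matrix.cons_val', Matrix.cons_val_zero,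
      Matrix.cons_val_one, Matrix.cons_val_fin_one, sub_zero]
    fun_prop

theorem lintegral_prior (αμ αw t : ℝ) {g : Param → ℝ≥0∞} (hg : Measurable g) :
    ∫⁻ θ, g θ ∂(prior αμ αw t) = ∫⁻ θ, ENNReal.ofReal (priorDensity αμ αw t θ) * g θ :=
  lintegral_withDensity_eq_lintegral_mul _ (measurable_priorDensity αμ αw t).ennreal_ofReal hg

theorem det_prec_ofRegression {c : ℝ} (hc : 0 < c) (b s m₀ m₁ : ℝ) :
    (Param.ofRegression c b s m₀ m₁).prec.det = c * s := by
  simp only [Param.prec, Param.ofRegression, Matrix.det_fin_two_of]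
  field_simp
  ring

theorem posDef_prec_ofRegression {c s : ℝ} (hc : 0 < c) (hs : 0 < s) (b m₀ m₁ : ℝ) :
    (Param.ofRegression c b s m₀ m₁).prec.PosDef := by
  refine (posDef_prec_iff _).2 ⟨hc, ?_⟩
  have h := det_prec_ofRegression hc b s m₀ m₁
  simp only [Param.prec, Param.ofRegression, Matrix.det_fin_two_of] at h ⊢
  have : 0 < c * s := by positivity
  nlinarith

/-- The coordinates diagonalise the quadratic form: `μᵀWμ = s m₀² + c m₁²`, while `|W| = c s`. The
exponent `(αw - 2) / 2` joins the Wishart power `(αw - 3) / 2` with the `|W| ^ (1 / 2)` of the mean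
density. -/
theorem priorDensity_ofRegression (αμ αw t : ℝ) {c s : ℝ} (hc : 0 < c) (hs : 0 < s)
    (b m₀ m₁ : ℝ) :
    priorDensity αμ αw t (Param.ofRegression c b s m₀ m₁) =
      αμ / (2 * Real.pi) / wishartConst (t • (1 : Matrix (Fin 2) (Fin 2) ℝ)) αw *
        (c ^ ((αw - 2) / 2) * s ^ ((αw - 2) / 2)) *
        Real.exp (-(1 / 2) * (t * (s + b ^ 2 / c + c) + αμ * (s * m₀ ^ 2 + c * m₁ ^ 2))) := by
  rw [priorDensity, wishartDensity, Set.indicator_of_mem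
    (show _ ∈ {W : Matrix (Fin 2) (Fin 2) ℝ | W.PosDef} from
      posDef_prec_ofRegression hc hs b m₀ m₁), meanDensity, det_prec_ofRegression hc]
  have hcs : 0 < c * s := by positivity
  have h1 : (c * s) ^ ((αw - 2) / 2) =
      (c * s) ^ ((αw - ((2 : ℕ) : ℝ) - 1) / 2) * (c * s) ^ (1 / 2 : ℝ) := by
    rw [← Real.rpow_add hcs]
    congr 1
    push_cast
    ring
  have h2 : ((2 : ℕ) : ℝ) / 2 = 1 := by norm_num
  rw [← Real.mul_rpow hc.le hs.le, h1, h2, Real.rpow_one, Real.rpow_one]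
  have h3 : ((t • (1 : Matrix (Fin 2) (Fin 2) ℝ)) *
      (Param.ofRegression c b s m₀ m₁).prec).trace = t * (s + b ^ 2 / c + c) := by
    simp [Param.prec, Param.ofRegression, Matrix.trace_fin_two]
    ring
  have h4 : (Matrix.vecMulVec ((Param.ofRegression c b s m₀ m₁).mean - 0)
      ((Param.ofRegression c b s m₀ m₁).mean - 0) *
      (αμ • (Param.ofRegression c b s m₀ m₁).prec)).trace =
      αμ * (s * m₀ ^ 2 + c * m₁ ^ 2) := by
    simp [Param.prec, Param.mean, Param.ofRegression, Matrix.trace_fin_two, Matrix.mul_apply,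
      Fin.sum_univ_two]
    field_simp
    ring
  rw [h3, h4, mul_add (-(1 / 2) : ℝ), Real.exp_add]
  ring

theorem wishartConst_pos {αw t : ℝ} (hαw : 3 < αw) (ht : 0 < t) :
    0 < wishartConst (t • (1 : Matrix (Fin 2) (Fin 2) ℝ)) αw := by
  have hG : 0 < multivariateGamma 2 (αw / 2) := by
    refine mul_pos (by positivity) (Finset.prod_pos fun j hj => Real.Gamma_pos_of_pos ?_)
    have : (j : ℝ) ≤ 2 := by exact_mod_cast (Finset.mem_Icc.1 hj).2
    linarith
  have hd : (t • (1 : Matrix (Fin 2) (Fin 2) ℝ)).det = t ^ 2 := by simp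
  rw [wishartConst, hd]
  positivity

/-- Integral against the prior of a Gaussian likelihood factorised along `X₁ → X₂`, with `N`
observations `y` of the first variable and `M` observations `(v, w)` in the regression. -/
theorem lintegral_prior_of_ofRegression {αμ αw t : ℝ} (hαμ : 0 < αμ) (hαw : 3 < αw) (ht : 0 < t)
    {N M : ℕ} (y : Fin N → ℝ) (v w : Fin M → ℝ) {D : ℝ} (hD : 0 ≤ D) {g : Param → ℝ≥0∞}
    (hg : Measurable g)
    (hgD : ∀ c b s m₀ m₁ : ℝ, 0 < c → 0 < s → g (Param.ofRegression c b s m₀ m₁) =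
      ENNReal.ofReal (D * (c ^ (M / 2 : ℝ) * s ^ (N / 2 : ℝ)) *
        Real.exp (-(1 / 2) * (s * ∑ k, (y k - m₀) ^ 2 +
          c * ∑ k, ((b / c * v k + 1 * w k) - m₁) ^ 2))))
    (hpos : 0 < (t + scatter αμ v v) * (t + scatter αμ w w) - scatter αμ v w ^ 2) :
    ∫⁻ θ, g θ ∂(prior αμ αw t) = ENNReal.ofReal
      (D * (αμ / (2 * Real.pi) / wishartConst (t • (1 : Matrix (Fin 2) (Fin 2) ℝ)) αw) *
        (√(2 * Real.pi / (αμ + N)) * √(2 * Real.pi / (αμ + M))) *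
        ((2 / (t + scatter αμ y y)) ^ ((αw + N - 1) / 2) * Real.Gamma ((αw + N - 1) / 2) *
          √(2 * Real.pi / (t + scatter αμ v v)) *
          ((2 * (t + scatter αμ v v) /
            ((t + scatter αμ v v) * (t + scatter αμ w w) - scatter αμ v w ^ 2)) ^ ((αw + M) / 2) *
            Real.Gamma ((αw + M) / 2)))) := by
  have hK := wishartConst_pos hαw ht
  set K := αμ / (2 * Real.pi) / wishartConst (t • (1 : Matrix (Fin 2) (Fin 2) ℝ)) αw with hKdef
  have hK0 : 0 < K := by positivity
  rw [lintegral_prior αμ αw t hg, lintegral_ofRegression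
    (g := fun θ => ENNReal.ofReal (priorDensity αμ αw t θ) * g θ)
    ((measurable_priorDensity αμ αw t).ennreal_ofReal.mul hg) ?_]
  · have hN0 : (0 : ℝ) ≤ N := Nat.cast_nonneg N
    have hM0 : (0 : ℝ) ≤ M := Nat.cast_nonneg M
    have hy := scatter_nonneg hαμ y
    have hv := scatter_nonneg hαμ v
    set E := D * K * (√(2 * Real.pi / (αμ + N)) * √(2 * Real.pi / (αμ + M))) with hE
    have hE0 : 0 ≤ E := by positivity
    rw [ENNReal.ofReal_mul hE0, ← lintegral_wishart (p := (αw + M) / 2) (q := (αw + N - 1) / 2)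
      (by linarith) (by linarith) (by linarith) (by linarith) hpos,
      ← lintegral_const_mul' _ _ ENNReal.ofReal_ne_top]
    refine setLIntegral_congr_fun measurableSet_Ioi fun c hc => ?_
    have hc : 0 < c := hc
    rw [← lintegral_const_mul' _ _ ENNReal.ofReal_ne_top]
    refine lintegral_congr fun b => ?_
    rw [← lintegral_const_mul' _ _ ENNReal.ofReal_ne_top]
    refine setLIntegral_congr_fun measurableSet_Ioi fun s hs => ?_
    have hs : 0 < s := hs
    -- The integrand splits into a factor in `m₀` and a factor in `m₁`, each of the form handled by
    -- `lintegral_mean`.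
    have hint : ∀ m₀ m₁ : ℝ, ENNReal.ofReal
        (priorDensity αμ αw t (Param.ofRegression c b s m₀ m₁)) *
          g (Param.ofRegression c b s m₀ m₁) =
        ENNReal.ofReal (D * K * (c ^ ((αw - 2) / 2) * s ^ ((αw - 2) / 2)) *
          (c ^ (M / 2 : ℝ) * s ^ (N / 2 : ℝ)) *
          Real.exp (-(1 / 2) * (t * (s + b ^ 2 / c + c)))) *
        (ENNReal.ofReal (Real.exp (-(1 / 2) * (s * (αμ * m₀ ^ 2 + ∑ k, (y k - m₀) ^ 2)))) *
        ENNReal.ofReal (Real.exp (-(1 / 2) * (c * (αμ * m₁ ^ 2 +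
          ∑ k, ((b / c * v k + 1 * w k) - m₁) ^ 2))))) := by
      intro m₀ m₁
      rw [hgD c b s m₀ m₁ hc hs, priorDensity_ofRegression αμ αw t hc hs,
        ← ENNReal.ofReal_mul (by positivity), ← ENNReal.ofReal_mul (by positivity),
        ← ENNReal.ofReal_mul (by positivity), ← hKdef]
      congr 1
      have hexp : ∀ a₁ a₂ a₃ b₁ b₂ : ℝ, a₁ + a₂ + a₃ = b₁ + b₂ →
          Real.exp a₁ * (Real.exp a₂ * Real.exp a₃) = Real.exp b₁ * Real.exp b₂ := by
        intro a₁ a₂ a₃ b₁ b₂ h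
        rw [← Real.exp_add, ← Real.exp_add, ← Real.exp_add, ← h]
        congr 1
        ring
      rw [mul_assoc _ (Real.exp (-(1 / 2) * (t * (s + b ^ 2 / c + c)))) _,
        hexp _ _ _ (-(1 / 2) * (t * (s + b ^ 2 / c + c) + αμ * (s * m₀ ^ 2 + c * m₁ ^ 2)))
          (-(1 / 2) * (s * ∑ k, (y k - m₀) ^ 2 + c * ∑ k, ((b / c * v k + 1 * w k) - m₁) ^ 2))
          (by ring)]
      ring
    simp_rw [hint]
    have hm : ∀ m₀ : ℝ, ∫⁻ m₁ : ℝ,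
        ENNReal.ofReal (D * K * (c ^ ((αw - 2) / 2) * s ^ ((αw - 2) / 2)) *
          (c ^ (M / 2 : ℝ) * s ^ (N / 2 : ℝ)) *
          Real.exp (-(1 / 2) * (t * (s + b ^ 2 / c + c)))) *
        (ENNReal.ofReal (Real.exp (-(1 / 2) * (s * (αμ * m₀ ^ 2 + ∑ k, (y k - m₀) ^ 2)))) *
        ENNReal.ofReal (Real.exp (-(1 / 2) * (c * (αμ * m₁ ^ 2 +
          ∑ k, ((b / c * v k + 1 * w k) - m₁) ^ 2))))) =
        ENNReal.ofReal (D * K * (c ^ ((αw - 2) / 2) * s ^ ((αw - 2) / 2)) *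
          (c ^ (M / 2 : ℝ) * s ^ (N / 2 : ℝ)) *
          Real.exp (-(1 / 2) * (t * (s + b ^ 2 / c + c)))) *
        (ENNReal.ofReal (Real.exp (-(1 / 2) * (s * (αμ * m₀ ^ 2 + ∑ k, (y k - m₀) ^ 2)))) *
        ENNReal.ofReal (√(2 * Real.pi / ((αμ + M) * c)) * Real.exp (-(1 / 2) * (c *
          scatter αμ (fun k => b / c * v k + 1 * w k) (fun k => b / c * v k + 1 * w k))))) := by
      intro m₀
      rw [lintegral_const_mul' _ _ ENNReal.ofReal_ne_top,
        lintegral_const_mul' _ _ ENNReal.ofReal_ne_top, lintegral_mean hαμ hc]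
    simp_rw [hm]
    rw [lintegral_const_mul' _ _ ENNReal.ofReal_ne_top,
      lintegral_mul_const' _ _ ENNReal.ofReal_ne_top, lintegral_mean hαμ hs,
      ← ENNReal.ofReal_mul (by positivity), ← ENNReal.ofReal_mul (by positivity),
      ← ENNReal.ofReal_mul (by positivity), scatter_add_mul]
    congr 1
    have e1 : √(2 * Real.pi / ((αμ + N) * s)) = √(2 * Real.pi / (αμ + N)) * s ^ (-(1 / 2) : ℝ) := by
      rw [← div_div, Real.sqrt_div (by positivity), Real.rpow_neg hs.le, ← Real.sqrt_eq_rpow]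
      rfl
    have e2 : √(2 * Real.pi / ((αμ + M) * c)) = √(2 * Real.pi / (αμ + M)) * c ^ (-(1 / 2) : ℝ) := by
      rw [← div_div, Real.sqrt_div (by positivity), Real.rpow_neg hc.le, ← Real.sqrt_eq_rpow]
      rfl
    -- The three powers come from the prior, the likelihood and the Gaussian integral over `m₁`;
    -- those of `s` in `e4` arise likewise, with `m₀`.
    have e3 : c ^ ((αw + M) / 2 - 3 / 2 : ℝ) =
        c ^ ((αw - 2) / 2) * c ^ (M / 2 : ℝ) * c ^ (-(1 / 2) : ℝ) := by
      rw [← Real.rpow_add hc, ← Real.rpow_add hc]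
      congr 1
      ring
    have e4 : s ^ ((αw + N - 1) / 2 - 1 : ℝ) =
        s ^ ((αw - 2) / 2) * s ^ (N / 2 : ℝ) * s ^ (-(1 / 2) : ℝ) := by
      rw [← Real.rpow_add hs, ← Real.rpow_add hs]
      congr 1
      ring
    have e5 : Real.exp (-(1 / 2) * ((t + scatter αμ y y) * s + (t + scatter αμ v v) * (b ^ 2 / c) +
        2 * scatter αμ v w * b + (t + scatter αμ w w) * c)) =
        Real.exp (-(1 / 2) * (t * (s + b ^ 2 / c + c))) *
        (Real.exp (-(1 / 2) * (s * scatter αμ y y)) *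
        Real.exp (-(1 / 2) * (c * ((b / c) ^ 2 * scatter αμ v v +
          2 * (b / c) * 1 * scatter αμ v w + 1 ^ 2 * scatter αμ w w)))) := by
      rw [← Real.exp_add, ← Real.exp_add]
      congr 1
      field_simp
      ring
    rw [e1, e2, e3, e4, e5, hE]
    ring
  · intro θ hθ
    have : priorDensity αμ αw t θ = 0 := by
      rw [priorDensity, wishartDensity, Set.indicator_of_notMem (by simpa using hθ), zero_mul]
    simp [this]

/-! ### Symmetry of the prior under exchange of the variables -/

/-- The exchange of the two variables, on parameters. -/
def Param.swap (θ : Param) : Param := (![θ.1 1, θ.1 0], (θ.2.2.2, θ.2.2.1, θ.2.1))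

theorem measurePreserving_swap_param : MeasurePreserving Param.swap volume volume := by
  have h1 : MeasurePreserving (fun m : Fin 2 → ℝ => ![m 1, m 0]) volume volume :=
    ((volume_preserving_finTwoArrow ℝ).symm).comp
      ((Measure.measurePreserving_swap (μ := (volume : Measure ℝ))
        (ν := (volume : Measure ℝ))).comp (volume_preserving_finTwoArrow ℝ))
  have hswap : MeasurePreserving (Prod.swap : ℝ × ℝ → ℝ × ℝ) volume volume :=
    Measure.measurePreserving_swap
  have hswap₁ : MeasurePreserving (Prod.swap : ℝ × ℝ × ℝ → (ℝ × ℝ) × ℝ) volume volume :=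
    Measure.measurePreserving_swap
  have hswap₂ : MeasurePreserving (Prod.swap : (ℝ × ℝ) × ℝ → ℝ × ℝ × ℝ) volume volume :=
    Measure.measurePreserving_swap
  have hassoc : MeasurePreserving
      (MeasurableEquiv.prodAssoc : (ℝ × ℝ) × ℝ ≃ᵐ ℝ × ℝ × ℝ) volume volume :=
    measurePreserving_prodAssoc volume volume volume
  have h2 : MeasurePreserving (fun w : ℝ × ℝ × ℝ => (w.2.2, w.2.1, w.1)) volume volume :=
    hswap₂.comp (hassoc.symm.comp (((MeasurePreserving.id volume).prod hswap).comp
      (hassoc.comp hswap₁)))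
  exact h1.prod h2

theorem priorDensity_swap (αμ αw t : ℝ) (θ : Param) :
    priorDensity αμ αw t θ.swap = priorDensity αμ αw t θ := by
  have hpd : θ.swap.prec.PosDef ↔ θ.prec.PosDef := by
    rw [posDef_prec_iff, posDef_prec_iff]
    simp only [Param.swap]
    constructor
    · rintro ⟨h1, h2⟩
      refine ⟨pos_of_mul_pos_left (a := θ.2.2.2) (b := θ.2.1) ?_ h1.le, by linarith⟩
      nlinarith [sq_nonneg θ.2.2.1]
    · rintro ⟨h1, h2⟩
      refine ⟨pos_of_mul_pos_left (a := θ.2.1) (b := θ.2.2.2) ?_ h1.le, by linarith⟩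
      nlinarith [sq_nonneg θ.2.2.1]
  have hdet : θ.swap.prec.det = θ.prec.det := by
    simp only [Param.swap, Param.prec, Matrix.det_fin_two_of]
    ring
  have htr : ((t • (1 : Matrix (Fin 2) (Fin 2) ℝ)) * θ.swap.prec).trace =
      ((t • (1 : Matrix (Fin 2) (Fin 2) ℝ)) * θ.prec).trace := by
    simp [Param.swap, Param.prec, Matrix.trace_fin_two]
    ring
  have htr' : (Matrix.vecMulVec (θ.swap.mean - 0) (θ.swap.mean - 0) *
      (αμ • θ.swap.prec)).trace =
      (Matrix.vecMulVec (θ.mean - 0) (θ.mean - 0) * (αμ • θ.prec)).trace := by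
    simp [Param.swap, Param.prec, Param.mean, Matrix.trace_fin_two, Matrix.mul_apply,
      Fin.sum_univ_two, Matrix.vecMulVec_apply]
    ring
  rw [priorDensity, priorDensity, meanDensity, meanDensity, htr', hdet]
  congr 1
  by_cases h : θ.prec.PosDef
  · rw [wishartDensity, Set.indicator_of_mem (by simpa using hpd.2 h),
      Set.indicator_of_mem (by simpa using h), htr, hdet]
  · rw [wishartDensity, Set.indicator_of_notMem (by simpa using mt hpd.1 h),
      Set.indicator_of_notMem (by simpa using h)]

/-- Since `ν = 0` and `T` is a multiple of the identity, the prior does not distinguish the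
variables. This reduces the marginal of the second variable to that of the first. -/
theorem lintegral_prior_swap (αμ αw t : ℝ) {g : Param → ℝ≥0∞} (hg : Measurable g) :
    ∫⁻ θ, g θ.swap ∂(prior αμ αw t) = ∫⁻ θ, g θ ∂(prior αμ αw t) := by
  have hs := measurePreserving_swap_param
  have hgs : Measurable fun θ : Param => g θ.swap := hg.comp hs.measurable
  rw [lintegral_prior _ _ _ hg, lintegral_prior _ _ _ hgs,
    ← hs.lintegral_comp (f := fun θ => ENNReal.ofReal (priorDensity αμ αw t θ) * g θ)
      ((measurable_priorDensity αμ αw t).ennreal_ofReal.mul hg)]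
  simp_rw [priorDensity_swap]

theorem scatter_mul_self_le {α : ℝ} (hα : 0 < α) {N : ℕ} (f g : Fin N → ℝ) :
    scatter α f g ^ 2 ≤ scatter α f f * scatter α g g := by
  have h : ∀ u : ℝ, 0 ≤ scatter α f f * (u * u) + 2 * scatter α f g * u + scatter α g g := by
    intro u
    have := scatter_nonneg hα (fun k => u * f k + 1 * g k)
    rw [scatter_add_mul] at this
    linarith
  have := discrim_le_zero h
  rw [discrim] at this
  linarith

/-- Expand and use Cauchy–Schwarz for the scatter. The bound holds for every data set, so it
controls the log determinant from below even on improbable samples. -/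
theorem sq_le_scatter_det {α t : ℝ} (hα : 0 < α) (ht : 0 < t) {N : ℕ} (f g : Fin N → ℝ) :
    t ^ 2 ≤ (t + scatter α f f) * (t + scatter α g g) - scatter α f g ^ 2 := by
  nlinarith [scatter_mul_self_le hα f g, scatter_nonneg hα f, scatter_nonneg hα g,
    mul_nonneg ht.le (scatter_nonneg hα f), mul_nonneg ht.le (scatter_nonneg hα g)]

/-! ### Closed forms of the marginal likelihoods -/

theorem prec_inv_zero (θ : Param) : (θ.prec)⁻¹ 0 0 = θ.2.2.2 / θ.prec.det := by
  rw [Matrix.inv_def, Matrix.adjugate_fin_two]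
  simp [Param.prec, div_eq_inv_mul]

theorem prec_inv_one (θ : Param) : (θ.prec)⁻¹ 1 1 = θ.2.1 / θ.prec.det := by
  rw [Matrix.inv_def, Matrix.adjugate_fin_two]
  simp [Param.prec, div_eq_inv_mul]

theorem measurable_det_prec : Measurable fun θ : Param => θ.prec.det := by
  simp only [Param.prec, Matrix.det_fin_two_of]
  fun_prop

theorem measurable_marginal (i : Fin 2) : Measurable (Param.marginal i) := by
  have h := measurable_det_prec
  refine Measurable.prodMk (by simp only [Param.mean]; fun_prop) ?_
  fin_cases i
  · simp only [Fin.zero_eta, prec_inv_zero]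
    fun_prop
  · simp only [Fin.mk_one, prec_inv_one]
    fun_prop

/-- The likelihood of the column `y` under the normal law with mean `η.1` and variance `η.2`. -/
def columnLikelihood {N : ℕ} (y : Fin N → ℝ) (η : ℝ × ℝ) : ℝ :=
  ∏ k, gaussianPDFReal η.1 η.2.toNNReal (y k)

theorem measurable_columnLikelihood {N : ℕ} (y : Fin N → ℝ) :
    Measurable (columnLikelihood y) := by
  unfold columnLikelihood
  simp only [gaussianPDFReal_def]
  fun_prop

theorem columnLikelihood_nonneg {N : ℕ} (y : Fin N → ℝ) (η : ℝ × ℝ) :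
    0 ≤ columnLikelihood y η :=
  Finset.prod_nonneg fun _ _ => gaussianPDFReal_nonneg _ _ _

/-- In regression coordinates the first variable has mean `m₀` and variance `s⁻¹`, so the regression
parameters `b`, `c`, `m₁` drop out. -/
theorem columnLikelihood_ofRegression {N : ℕ} (y : Fin N → ℝ) {c s : ℝ} (hc : 0 < c)
    (hs : 0 < s) (b m₀ m₁ : ℝ) :
    columnLikelihood y (Param.marginal 0 (Param.ofRegression c b s m₀ m₁)) =
      ((√(2 * Real.pi))⁻¹) ^ N * s ^ (N / 2 : ℝ) *
        Real.exp (-(1 / 2) * (s * ∑ k, (y k - m₀) ^ 2)) := by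
  have hv : ((Param.ofRegression c b s m₀ m₁).prec)⁻¹ 0 0 = s⁻¹ := by
    rw [prec_inv_zero, det_prec_ofRegression hc]
    simp only [Param.ofRegression]
    field_simp
  have hm : (Param.ofRegression c b s m₀ m₁).mean 0 = m₀ := rfl
  have hpdf : ∀ k, gaussianPDFReal m₀ (s⁻¹).toNNReal (y k) =
      (√(2 * Real.pi))⁻¹ * √s * Real.exp (-(1 / 2) * (s * (y k - m₀) ^ 2)) := by
    intro k
    rw [gaussianPDFReal, Real.coe_toNNReal _ (by positivity), Real.sqrt_mul (by positivity),
      Real.sqrt_inv, mul_inv, inv_inv]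
    congr 2
    field_simp
  simp only [columnLikelihood, Param.marginal, hv, hm, hpdf]
  rw [Finset.prod_mul_distrib, ← Real.exp_sum, ← Finset.mul_sum, ← Finset.mul_sum,
    Finset.prod_const, Finset.card_univ, Fintype.card_fin, mul_pow]
  congr 2
  rw [Real.sqrt_eq_rpow, ← Real.rpow_natCast, ← Real.rpow_mul hs.le]
  congr 1
  ring

theorem columnLikelihood_swap {N : ℕ} (y : Fin N → ℝ) (θ : Param) :
    columnLikelihood y (Param.marginal 0 θ.swap) = columnLikelihood y (Param.marginal 1 θ) := by
  have : Param.marginal 0 θ.swap = Param.marginal 1 θ := by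
    refine Prod.ext rfl ?_
    simp only [Param.marginal]
    rw [prec_inv_zero, prec_inv_one]
    simp only [Param.swap, Param.prec, Matrix.det_fin_two_of]
    ring
  rw [this]

theorem lintegral_columnLikelihood {αμ αw t : ℝ} (hαμ : 0 < αμ) (hαw : 3 < αw) (ht : 0 < t)
    {N : ℕ} (y : Fin N → ℝ) (i : Fin 2) :
    ∫⁻ θ, ENNReal.ofReal (columnLikelihood y (Param.marginal i θ)) ∂(prior αμ αw t) =
      ENNReal.ofReal (((√(2 * Real.pi))⁻¹) ^ N *
        (αμ / (2 * Real.pi) / wishartConst (t • (1 : Matrix (Fin 2) (Fin 2) ℝ)) αw) *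
        (√(2 * Real.pi / (αμ + N)) * √(2 * Real.pi / αμ)) *
        ((2 / (t + scatter αμ y y)) ^ ((αw + N - 1) / 2) * Real.Gamma ((αw + N - 1) / 2) *
          √(2 * Real.pi / t) * ((2 / t) ^ (αw / 2) * Real.Gamma (αw / 2)))) := by
  have hmeas : Measurable fun θ => ENNReal.ofReal (columnLikelihood y (Param.marginal 0 θ)) :=
    ((measurable_columnLikelihood y).comp (measurable_marginal 0)).ennreal_ofReal
  have h0 : ∫⁻ θ, ENNReal.ofReal (columnLikelihood y (Param.marginal 0 θ)) ∂(prior αμ αw t) =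
      ENNReal.ofReal (((√(2 * Real.pi))⁻¹) ^ N *
        (αμ / (2 * Real.pi) / wishartConst (t • (1 : Matrix (Fin 2) (Fin 2) ℝ)) αw) *
        (√(2 * Real.pi / (αμ + N)) * √(2 * Real.pi / αμ)) *
        ((2 / (t + scatter αμ y y)) ^ ((αw + N - 1) / 2) * Real.Gamma ((αw + N - 1) / 2) *
          √(2 * Real.pi / t) * ((2 / t) ^ (αw / 2) * Real.Gamma (αw / 2)))) := by
    have hz : ∀ f g : Fin 0 → ℝ, scatter αμ f g = 0 := fun f g => by simp [scatter]
    -- A single column is the case `M = 0`, with no observations in the regression, whose parameters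
    -- are then integrated against the prior alone.
    rw [lintegral_prior_of_ofRegression hαμ hαw ht y (Fin.elim0 : Fin 0 → ℝ)
      (Fin.elim0 : Fin 0 → ℝ) (D := ((√(2 * Real.pi))⁻¹) ^ N) (by positivity) hmeas ?_ ?_]
    · simp only [hz, Nat.cast_zero, add_zero]
      congr 5
      field_simp
      ring
    · intro c b s m₀ m₁ hc hs
      rw [columnLikelihood_ofRegression y hc hs]
      simp
    · simp only [hz]
      nlinarith
  fin_cases i
  · exact h0
  · rw [← h0, ← lintegral_prior_swap _ _ _ hmeas]
    simp_rw [columnLikelihood_swap]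
    rfl

theorem integral_columnLikelihood {αμ αw t : ℝ} (hαμ : 0 < αμ) (hαw : 3 < αw) (ht : 0 < t)
    {N : ℕ} (y : Fin N → ℝ) (i : Fin 2) :
    ∫ η, columnLikelihood y η ∂((prior αμ αw t).map (Param.marginal i)) =
      ((√(2 * Real.pi))⁻¹) ^ N *
        (αμ / (2 * Real.pi) / wishartConst (t • (1 : Matrix (Fin 2) (Fin 2) ℝ)) αw) *
        (√(2 * Real.pi / (αμ + N)) * √(2 * Real.pi / αμ)) *
        ((2 / (t + scatter αμ y y)) ^ ((αw + N - 1) / 2) * Real.Gamma ((αw + N - 1) / 2) *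
          √(2 * Real.pi / t) * ((2 / t) ^ (αw / 2) * Real.Gamma (αw / 2))) := by
  have hK := wishartConst_pos hαw ht
  have hy := scatter_nonneg hαμ y
  have hN : (0 : ℝ) ≤ N := Nat.cast_nonneg N
  have hG := Real.Gamma_pos_of_pos (show 0 < (αw + N - 1) / 2 by linarith)
  have hG' := Real.Gamma_pos_of_pos (show 0 < αw / 2 by linarith)
  rw [integral_map (measurable_marginal i).aemeasurable
    (measurable_columnLikelihood y).aestronglyMeasurable,
    integral_eq_lintegral_of_nonneg_ae
      (Filter.Eventually.of_forall fun θ => columnLikelihood_nonneg _ _)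
      ((measurable_columnLikelihood y).comp (measurable_marginal i)).aestronglyMeasurable,
    lintegral_columnLikelihood hαμ hαw ht, ENNReal.toReal_ofReal]
  positivity

/-- This is all that Fubini needs for the product prior of the empty graph; the total mass of the
prior is never computed. -/
instance (αμ αw t : ℝ) : SFinite (prior αμ αw t) := by
  unfold prior
  infer_instance

theorem marginalLikelihood_empty (αμ αw t : ℝ) {N : ℕ} (x : Fin N → Fin 2 → ℝ) :
    marginalLikelihood αμ αw t x .empty =
      (∫ η, columnLikelihood (fun k => x k 0) η ∂((prior αμ αw t).map (Param.marginal 0))) *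
      ∫ η, columnLikelihood (fun k => x k 1) η ∂((prior αμ αw t).map (Param.marginal 1)) := by
  rw [← integral_prod_mul]
  simp only [marginalLikelihood, columnLikelihood, Finset.prod_mul_distrib]

theorem mvnDensity_nonneg {n : ℕ} (μ : Fin n → ℝ) (W : Matrix (Fin n) (Fin n) ℝ)
    (x : Fin n → ℝ) : 0 ≤ mvnDensity μ W x := by
  rw [mvnDensity, ← Real.sqrt_eq_rpow]
  positivity

theorem measurable_mvnDensity (x : Fin 2 → ℝ) :
    Measurable fun θ : Param => mvnDensity θ.mean θ.prec x := by
  simp only [mvnDensity, Param.prec, Param.mean, Matrix.det_fin_two_of, Matrix.mulVec, dotProduct,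
    Fin.sum_univ_two, Pi.sub_apply, Matrix.of_apply, Matrix.cons_val', Matrix.cons_val_zero,
    Matrix.cons_val_one, Matrix.cons_val_fin_one]
  fun_prop

/-- The joint density is the density of X₁ times that of X₂ given X₁: completing the square in the
second coordinate leaves precision `s` for the first variable and `c` for the residual, with slope
`-b / c`. -/
theorem prod_mvnDensity_ofRegression {N : ℕ} (x : Fin N → Fin 2 → ℝ) {c s : ℝ} (hc : 0 < c)
    (hs : 0 < s) (b m₀ m₁ : ℝ) :
    ∏ k, mvnDensity (Param.ofRegression c b s m₀ m₁).mean
        (Param.ofRegression c b s m₀ m₁).prec (x k) =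
      ((2 * Real.pi)⁻¹) ^ N * (c ^ (N / 2 : ℝ) * s ^ (N / 2 : ℝ)) *
        Real.exp (-(1 / 2) * (s * ∑ k, (x k 0 - m₀) ^ 2 +
          c * ∑ k, ((b / c * x k 0 + 1 * x k 1) - m₁) ^ 2)) := by
  have hk : ∀ k, mvnDensity (Param.ofRegression c b s m₀ m₁).mean
        (Param.ofRegression c b s m₀ m₁).prec (x k) =
      (2 * Real.pi)⁻¹ * (√c * √s) * Real.exp (-(1 / 2) * (s * (x k 0 - m₀) ^ 2 +
          c * ((b / c * x k 0 + 1 * x k 1) - m₁) ^ 2)) := by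
    intro k
    have h2 : ((2 : ℕ) : ℝ) / 2 = 1 := by norm_num
    rw [mvnDensity, det_prec_ofRegression hc, ← Real.sqrt_eq_rpow, Real.sqrt_mul hc.le, h2,
      Real.rpow_one, div_eq_inv_mul]
    congr 3
    simp only [Param.ofRegression, Param.prec, Param.mean, Matrix.mulVec, dotProduct,
      Fin.sum_univ_two, Pi.sub_apply, Matrix.of_apply, Matrix.cons_val', Matrix.cons_val_zero,
      Matrix.cons_val_one, Matrix.cons_val_fin_one]
    field_simp
    ring
  simp only [hk]
  rw [Finset.prod_mul_distrib, ← Real.exp_sum, ← Finset.mul_sum, Finset.sum_add_distrib,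
    ← Finset.mul_sum, ← Finset.mul_sum, Finset.prod_const, Finset.card_univ, Fintype.card_fin,
    mul_pow, mul_pow]
  have hr : ∀ z : ℝ, 0 < z → √z ^ N = z ^ (N / 2 : ℝ) := by
    intro z hz
    rw [Real.sqrt_eq_rpow, ← Real.rpow_natCast, ← Real.rpow_mul hz.le]
    congr 1
    ring
  rw [hr c hc, hr s hs]

theorem marginalLikelihood_oneToTwo {αμ αw t : ℝ} (hαμ : 0 < αμ) (hαw : 3 < αw) (ht : 0 < t)
    {N : ℕ} (x : Fin N → Fin 2 → ℝ) {f g : Fin N → ℝ} (hf : f = fun k => x k 0)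
    (hg : g = fun k => x k 1) :
    marginalLikelihood αμ αw t x .oneToTwo =
      ((2 * Real.pi)⁻¹) ^ N *
        (αμ / (2 * Real.pi) / wishartConst (t • (1 : Matrix (Fin 2) (Fin 2) ℝ)) αw) *
        (√(2 * Real.pi / (αμ + N)) * √(2 * Real.pi / (αμ + N))) *
        ((2 / (t + scatter αμ f f)) ^ ((αw + N - 1) / 2) * Real.Gamma ((αw + N - 1) / 2) *
          √(2 * Real.pi / (t + scatter αμ f f)) *
          ((2 * (t + scatter αμ f f) /
            ((t + scatter αμ f f) * (t + scatter αμ g g) - scatter αμ f g ^ 2)) ^ ((αw + N) / 2) *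
            Real.Gamma ((αw + N) / 2))) := by
  have hK := wishartConst_pos hαw ht
  have hN : (0 : ℝ) ≤ N := Nat.cast_nonneg N
  have hG := Real.Gamma_pos_of_pos (show 0 < (αw + N - 1) / 2 by linarith)
  have hG' := Real.Gamma_pos_of_pos (show 0 < (αw + N) / 2 by linarith)
  have hff := scatter_nonneg hαμ f
  have hdet : 0 < (t + scatter αμ f f) * (t + scatter αμ g g) - scatter αμ f g ^ 2 :=
    (by positivity : 0 < t ^ 2).trans_le (sq_le_scatter_det hαμ ht f g)
  have hmeas : Measurable fun θ : Param => ∏ k, mvnDensity θ.mean θ.prec (x k) :=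
    Finset.measurable_prod _ fun k _ => measurable_mvnDensity (x k)
  rw [marginalLikelihood, integral_eq_lintegral_of_nonneg_ae
      (Filter.Eventually.of_forall fun θ => Finset.prod_nonneg fun k _ => mvnDensity_nonneg _ _ _)
      hmeas.aestronglyMeasurable,
    lintegral_prior_of_ofRegression hαμ hαw ht f f g (D := ((2 * Real.pi)⁻¹) ^ N) (by positivity)
      hmeas.ennreal_ofReal ?_ hdet, ENNReal.toReal_ofReal]
  · positivity
  · intro c b s m₀ m₁ hc hs
    rw [prod_mvnDensity_ofRegression x hc hs, hf, hg]

/-! ### The log posterior ratio -/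

/-- The log posterior ratio in closed form, up to a constant that depends only on the
hyperparameters. -/
theorem exists_logPosteriorRatio_eq {αμ αw t : ℝ} (hαμ : 0 < αμ) (hαw : 3 < αw) (ht : 0 < t)
    {p : DAG → ℝ} (hp : ∀ G, 0 ≤ p G) (hp_empty : 0 < p .empty) (hp_edge : 0 < p .oneToTwo) :
    ∃ C : ℝ, ∀ (N : ℕ) (x : Fin N → Fin 2 → ℝ) (f g : Fin N → ℝ), (f = fun k => x k 0) →
      (g = fun k => x k 1) → logPosteriorRatio αμ αw t p x =
        C + Real.log (Real.Gamma ((αw + N) / 2)) - Real.log (Real.Gamma ((αw + N - 1) / 2)) +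
          (αw + N - 1) / 2 *
            (Real.log (t + scatter αμ f f) + Real.log (t + scatter αμ g g)) -
          (αw + N) / 2 *
            Real.log ((t + scatter αμ f f) * (t + scatter αμ g g) - scatter αμ f g ^ 2) := by
  have hK := wishartConst_pos hαw ht
  set K := αμ / (2 * Real.pi) / wishartConst (t • (1 : Matrix (Fin 2) (Fin 2) ℝ)) αw with hKdef
  have hK0 : 0 < K := by positivity
  -- These are the terms free of `N` and of the data. The terms `N * log (2π)` and `log (αμ + N)`
  -- cancel between the edge and the two columns. The logarithm of the first diagonal entry cancels
  -- within the edge likelihood, with coefficients `-(αw + N - 1) / 2 - 1 / 2 + (αw + N) / 2`.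
  refine ⟨Real.log (p .oneToTwo) - Real.log (p .empty) - Real.log K -
    (Real.log (2 * Real.pi) - Real.log αμ) + 1 / 2 * Real.log 2 + 1 / 2 * Real.log (2 * Real.pi) -
    (Real.log (2 * Real.pi) - Real.log t) - αw * (Real.log 2 - Real.log t) -
    2 * Real.log (Real.Gamma (αw / 2)), fun N x f g hf hg => ?_⟩
  have hN : (0 : ℝ) ≤ N := Nat.cast_nonneg N
  have hG := Real.Gamma_pos_of_pos (show 0 < (αw + N - 1) / 2 by linarith)
  have hG₁ := Real.Gamma_pos_of_pos (show 0 < (αw + N) / 2 by linarith)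
  have hG₂ := Real.Gamma_pos_of_pos (show 0 < αw / 2 by linarith)
  have hff : 0 < t + scatter αμ f f := by linarith [scatter_nonneg hαμ f]
  have hgg : 0 < t + scatter αμ g g := by linarith [scatter_nonneg hαμ g]
  have hdet : 0 < (t + scatter αμ f f) * (t + scatter αμ g g) - scatter αμ f g ^ 2 :=
    (by positivity : 0 < t ^ 2).trans_le (sq_le_scatter_det hαμ ht f g)
  have hE := marginalLikelihood_oneToTwo hαμ hαw ht x hf hg
  have hM := marginalLikelihood_empty αμ αw t x
  rw [integral_columnLikelihood hαμ hαw ht, integral_columnLikelihood hαμ hαw ht, ← hf, ← hg,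
    ← hKdef] at hM
  rw [← hKdef] at hE
  set A := t + scatter αμ f f
  set B := t + scatter αμ g g
  set Δ := A * B - scatter αμ f g ^ 2
  set E := marginalLikelihood αμ αw t x .oneToTwo with hEdef
  set M := marginalLikelihood αμ αw t x .empty with hMdef
  have hE0 : 0 < E := by rw [hE]; positivity
  have hM0 : 0 < M := by rw [hM]; positivity
  have hden : 0 < p .empty * M + p .oneToTwo * E +
      p .twoToOne * marginalLikelihood αμ αw t x .twoToOne := by
    have : marginalLikelihood αμ αw t x .twoToOne = E := rfl
    rw [this]
    have := mul_nonneg (hp .twoToOne) hE0.le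
    positivity
  have hratio : logPosteriorRatio αμ αw t p x =
      Real.log (p .oneToTwo) + Real.log E - (Real.log (p .empty) + Real.log M) := by
    rw [logPosteriorRatio, posterior, posterior, ← hEdef, ← hMdef, div_div_div_cancel_right₀
      hden.ne', Real.log_div (by positivity) (by positivity), Real.log_mul (by positivity)
      (by positivity), Real.log_mul (by positivity) (by positivity)]
  clear_value K A B Δ E M
  have hσ : 0 < 2 * Real.pi := by positivity
  -- Made atomic so that the logarithm rules below do not split the product.
  generalize 2 * Real.pi = σ at hσ hE hM ⊢
  have hlogE : Real.log E = -(N * Real.log σ) + Real.log K +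
      (Real.log σ - Real.log (αμ + N)) +
      ((αw + N - 1) / 2 * (Real.log 2 - Real.log A) + Real.log (Real.Gamma ((αw + N - 1) / 2)) +
        1 / 2 * (Real.log σ - Real.log A) +
        ((αw + N) / 2 * (Real.log 2 + Real.log A - Real.log Δ) +
          Real.log (Real.Gamma ((αw + N) / 2)))) := by
    rw [hE, Real.mul_self_sqrt (by positivity), Real.log_mul (by positivity) (by positivity),
      Real.log_mul (by positivity) (by positivity), Real.log_mul (by positivity) (by positivity),
      Real.log_mul (by positivity) (by positivity), Real.log_mul (by positivity) (by positivity),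
      Real.log_mul (by positivity) (by positivity), Real.log_mul (by positivity) (by positivity),
      Real.log_pow, Real.log_inv, Real.log_rpow (by positivity), Real.log_rpow (by positivity),
      Real.log_sqrt (by positivity), Real.log_div (by positivity) (by positivity),
      Real.log_div (by positivity) (by positivity), Real.log_div (by positivity) (by positivity),
      Real.log_div (by positivity) (by positivity), Real.log_mul two_ne_zero (by positivity)]
    ring
  have hlogM : ∀ T : ℝ, 0 < T → Real.log (((√σ)⁻¹) ^ N * K *
        (√(σ / (αμ + N)) * √(σ / αμ)) *
        ((2 / T) ^ ((αw + N - 1) / 2) * Real.Gamma ((αw + N - 1) / 2) *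
          √(σ / t) * ((2 / t) ^ (αw / 2) * Real.Gamma (αw / 2)))) =
      -(N * (Real.log σ / 2)) + Real.log K +
      (1 / 2 * (Real.log σ - Real.log (αμ + N)) +
        1 / 2 * (Real.log σ - Real.log αμ)) +
      ((αw + N - 1) / 2 * (Real.log 2 - Real.log T) + Real.log (Real.Gamma ((αw + N - 1) / 2)) +
        1 / 2 * (Real.log σ - Real.log t) +
        (αw / 2 * (Real.log 2 - Real.log t) + Real.log (Real.Gamma (αw / 2)))) := by
    intro T hT
    rw [Real.log_mul (by positivity) (by positivity),
      Real.log_mul (by positivity) (by positivity), Real.log_mul (by positivity) (by positivity),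
      Real.log_mul (by positivity) (by positivity), Real.log_mul (by positivity) (by positivity),
      Real.log_mul (by positivity) (by positivity), Real.log_mul (by positivity) (by positivity),
      Real.log_mul (by positivity) (by positivity),
      Real.log_pow, Real.log_inv, Real.log_rpow (by positivity), Real.log_rpow (by positivity),
      Real.log_sqrt (by positivity), Real.log_sqrt (by positivity), Real.log_sqrt (by positivity),
      Real.log_sqrt (by positivity), Real.log_div (by positivity) (by positivity),
      Real.log_div (by positivity) (by positivity), Real.log_div (by positivity) (by positivity),
      Real.log_div (by positivity) (by positivity), Real.log_div (by positivity) (by positivity)]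
    ring
  rw [hratio, hlogE, hM, Real.log_mul (by positivity) (by positivity), hlogM A hff, hlogM B hgg]
  ring

/-! ### Growth of the Gamma quotient -/

theorem abs_log_Gamma_add_half_sub_le {x : ℝ} (hx : 1 ≤ x) :
    |Real.log (Real.Gamma (x + 1 / 2)) - Real.log (Real.Gamma x)| ≤
      1 / 2 * Real.log (x + 1 / 2) := by
  have hx0 : 0 < x := by linarith
  -- Log-convexity of Gamma at the midpoint of `y` and `y + 1`. Applied at `x` it bounds the half
  -- step from above, applied at `x + 1 / 2` from below.
  have hmid : ∀ y : ℝ, 0 < y → Real.log (Real.Gamma (y + 1 / 2)) ≤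
      Real.log (Real.Gamma y) + 1 / 2 * Real.log y := by
    intro y hy
    have h := Real.convexOn_log_Gamma.2 (show y ∈ Set.Ioi 0 from hy)
      (show y + 1 ∈ Set.Ioi (0 : ℝ) from by simp only [Set.mem_Ioi]; linarith)
      (by norm_num : (0 : ℝ) ≤ 1 / 2) (by norm_num : (0 : ℝ) ≤ 1 / 2) (by norm_num)
    simp only [smul_eq_mul, Function.comp_apply] at h
    rw [show 1 / 2 * y + 1 / 2 * (y + 1) = y + 1 / 2 by ring, Real.Gamma_add_one hy.ne',
      Real.log_mul hy.ne' (Real.Gamma_pos_of_pos hy).ne'] at h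
    linarith
  have h1 := hmid x hx0
  have h2 := hmid (x + 1 / 2) (by linarith)
  rw [show x + 1 / 2 + 1 / 2 = x + 1 by ring, Real.Gamma_add_one hx0.ne',
      Real.log_mul hx0.ne' (Real.Gamma_pos_of_pos hx0).ne'] at h2
  have h3 : Real.log x ≤ Real.log (x + 1 / 2) := Real.log_le_log hx0 (by linarith)
  have h4 : 0 ≤ Real.log x := Real.log_nonneg hx
  rw [abs_le]
  constructor <;> linarith

theorem tendsto_log_Gamma_sub_div {αw : ℝ} (hαw : 3 < αw) :
    Filter.Tendsto (fun N : ℕ => (Real.log (Real.Gamma ((αw + N) / 2)) -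
      Real.log (Real.Gamma ((αw + N - 1) / 2))) / N) Filter.atTop (nhds 0) := by
  -- The denominator is `N`, written as an affine function of `(αw + N) / 2`.
  have hlim : Filter.Tendsto (fun N : ℕ => Real.log ((αw + N) / 2) ^ 1 /
      (2 * ((αw + N) / 2) + -αw)) Filter.atTop (nhds 0) := by
    refine (Real.tendsto_pow_log_div_mul_add_atTop 2 (-αw) 1 two_ne_zero).comp ?_
    exact (Filter.tendsto_atTop_add_const_left _ _ tendsto_natCast_atTop_atTop).atTop_div_const
      (by norm_num)
  have hlim' := hlim.const_mul (1 / 2 : ℝ)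
  rw [mul_zero] at hlim'
  refine squeeze_zero_norm (fun N => ?_) hlim'
  have hN : (0 : ℝ) ≤ N := Nat.cast_nonneg N
  have h := abs_log_Gamma_add_half_sub_le (x := (αw + N - 1) / 2) (by linarith)
  rw [show (αw + N - 1) / 2 + 1 / 2 = (αw + N) / 2 by ring] at h
  rw [norm_div, Real.norm_eq_abs, Real.norm_of_nonneg hN,
    show 2 * ((αw + N) / 2) + -αw = (N : ℝ) by ring, pow_one, ← mul_div_assoc]
  gcongr

theorem tendsto_log_natCast_div : Filter.Tendsto (fun N : ℕ => Real.log N / N)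
    Filter.atTop (nhds 0) := by
  have h := (Real.tendsto_pow_log_div_mul_add_atTop 1 0 1 one_ne_zero).comp
    (tendsto_natCast_atTop_atTop (R := ℝ))
  simpa [Function.comp_def] using h

/-! ### Truncation decreases the scatter matrix -/

theorem weighted_le_mul_scatter {α : ℝ} (hα : 0 < α) {N : ℕ} {w : Fin N → ℝ}
    (hw0 : ∀ k, 0 ≤ w k) (hw1 : ∀ k, w k ≤ 1) (f : Fin N → ℝ) :
    (∑ k, w k) * (∑ k, w k * f k * f k) - (∑ k, w k * f k) ^ 2 ≤ N * scatter α f f := by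
  -- The left side is the total weight times the weighted sum of squares about the weighted mean,
  -- which minimises that sum; the centre `m` is therefore no better, and weights at most 1 only
  -- shrink the sum about `m`.
  set m := (∑ k, f k) / (α + N) with hm
  have h1 : ∑ k, w k * (f k - m) ^ 2 ≤ scatter α f f := by
    have h := sum_sq_sub_add_eq_scatter hα f m
    rw [← hm, sub_self] at h
    have h2 : ∑ k, w k * (f k - m) ^ 2 ≤ ∑ k, (f k - m) ^ 2 :=
      Finset.sum_le_sum fun k _ => mul_le_of_le_one_left (sq_nonneg _) (hw1 k)
    nlinarith [sq_nonneg m]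
  have h2 : ∑ k, w k * (f k - m) ^ 2 =
      ∑ k, w k * f k * f k - 2 * m * ∑ k, w k * f k + m ^ 2 * ∑ k, w k := by
    rw [Finset.mul_sum, Finset.mul_sum, ← Finset.sum_sub_distrib, ← Finset.sum_add_distrib]
    exact Finset.sum_congr rfl fun k _ => by ring
  have hW0 : 0 ≤ ∑ k, w k := Finset.sum_nonneg fun k _ => hw0 k
  have hWN : ∑ k, w k ≤ N := by
    calc ∑ k, w k ≤ ∑ _k : Fin N, (1 : ℝ) := Finset.sum_le_sum fun k _ => hw1 k
      _ = N := by simp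
  have h3 : (∑ k, w k) * ∑ k, w k * (f k - m) ^ 2 ≤ (∑ k, w k) * scatter α f f :=
    mul_le_mul_of_nonneg_left h1 hW0
  have h4 : (∑ k, w k) * scatter α f f ≤ N * scatter α f f :=
    mul_le_mul_of_nonneg_right hWN (scatter_nonneg hα f)
  rw [h2] at h3
  nlinarith [sq_nonneg (∑ k, w k * f k - m * ∑ k, w k)]

theorem weighted_sq_le {N : ℕ} {w : Fin N → ℝ} (hw0 : ∀ k, 0 ≤ w k) (f : Fin N → ℝ) :
    (∑ k, w k * f k) ^ 2 ≤ (∑ k, w k) * (∑ k, w k * f k * f k) :=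
  Finset.sum_sq_le_sum_mul_sum_of_sq_le_mul _ (fun k _ => hw0 k)
    (fun k _ => by rw [mul_assoc]; exact mul_nonneg (hw0 k) (mul_self_nonneg _))
    (fun k _ => le_of_eq (by ring))

/-- A real quadratic form in two variables that is nonnegative has nonnegative determinant. -/
theorem sq_le_mul_of_quadratic_nonneg {a b c : ℝ}
    (h : ∀ u v : ℝ, 0 ≤ u ^ 2 * a + 2 * u * v * b + v ^ 2 * c) : b ^ 2 ≤ a * c := by
  have h' : ∀ u : ℝ, 0 ≤ a * (u * u) + 2 * b * u + c := fun u => by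
    have := h u 1
    linarith
  have := discrim_le_zero h'
  rw [discrim] at this
  linarith

/-- The determinant is monotone on positive semidefinite `2 × 2` matrices. -/
theorem det_le_det_of_quadratic_le {a b c a' b' c' : ℝ}
    (h : ∀ u v : ℝ, 0 ≤ u ^ 2 * a + 2 * u * v * b + v ^ 2 * c)
    (h' : ∀ u v : ℝ, u ^ 2 * a + 2 * u * v * b + v ^ 2 * c ≤
      u ^ 2 * a' + 2 * u * v * b' + v ^ 2 * c') :
    a * c - b ^ 2 ≤ a' * c' - b' ^ 2 := by
  have hD : ∀ u v : ℝ, 0 ≤ u ^ 2 * (a' - a) + 2 * u * v * (b' - b) + v ^ 2 * (c' - c) := by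
    intro u v
    linarith [h' u v]
  have h1 := sq_le_mul_of_quadratic_nonneg h
  have h2 := sq_le_mul_of_quadratic_nonneg hD
  have ha : 0 ≤ a := by simpa using h 1 0
  have hc : 0 ≤ c := by simpa using h 0 1
  have ha' : 0 ≤ a' - a := by simpa using hD 1 0
  have hc' : 0 ≤ c' - c := by simpa using hD 0 1
  -- The determinant of the sum of the smaller matrix and the difference is the two determinants
  -- plus a mixed term. The mixed term is nonnegative by this inequality and AM–GM.
  have h3 : (b * (b' - b)) ^ 2 ≤ (a * (c' - c)) * (c * (a' - a)) := by
    calc (b * (b' - b)) ^ 2 = b ^ 2 * (b' - b) ^ 2 := by ring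
      _ ≤ (a * c) * ((a' - a) * (c' - c)) :=
        mul_le_mul h1 h2 (sq_nonneg _) (mul_nonneg ha hc)
      _ = _ := by ring
  have h4 : 2 * (b * (b' - b)) ≤ a * (c' - c) + c * (a' - a) := by
    refine le_of_sq_le_sq ?_ (by positivity)
    nlinarith [sq_nonneg (a * (c' - c) - c * (a' - a))]
  nlinarith

/-- `weighted_le_mul_scatter` for every combination `u * f + v * g` compares the two quadratic
forms, and the determinant is monotone. The left side is a polynomial in weighted empirical moments,
open to a law of large numbers. -/
theorem weighted_det_le {α t : ℝ} (hα : 0 < α) (ht : 0 < t) {N : ℕ} (hN : 0 < N) {w : Fin N → ℝ}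
    (hw0 : ∀ k, 0 ≤ w k) (hw1 : ∀ k, w k ≤ 1) (f g : Fin N → ℝ) :
    ((∑ k, w k) / N * ((∑ k, w k * f k * f k) / N) - ((∑ k, w k * f k) / N) ^ 2) *
      ((∑ k, w k) / N * ((∑ k, w k * g k * g k) / N) - ((∑ k, w k * g k) / N) ^ 2) -
      ((∑ k, w k) / N * ((∑ k, w k * f k * g k) / N) -
        (∑ k, w k * f k) / N * ((∑ k, w k * g k) / N)) ^ 2 ≤
      ((t + scatter α f f) * (t + scatter α g g) - scatter α f g ^ 2) / N ^ 2 := by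
  have hN' : (0 : ℝ) < N := by exact_mod_cast hN
  have hform : ∀ u v : ℝ,
      u ^ 2 * ((∑ k, w k) / N * ((∑ k, w k * f k * f k) / N) - ((∑ k, w k * f k) / N) ^ 2) +
      2 * u * v * ((∑ k, w k) / N * ((∑ k, w k * f k * g k) / N) -
        (∑ k, w k * f k) / N * ((∑ k, w k * g k) / N)) +
      v ^ 2 * ((∑ k, w k) / N * ((∑ k, w k * g k * g k) / N) - ((∑ k, w k * g k) / N) ^ 2) =
      ((∑ k, w k) * (∑ k, w k * (u * f k + v * g k) * (u * f k + v * g k)) -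
        (∑ k, w k * (u * f k + v * g k)) ^ 2) / N ^ 2 := by
    intro u v
    have e1 : ∑ k, w k * (u * f k + v * g k) * (u * f k + v * g k) =
        u ^ 2 * ∑ k, w k * f k * f k + 2 * u * v * ∑ k, w k * f k * g k +
          v ^ 2 * ∑ k, w k * g k * g k := by
      simp only [Finset.mul_sum, ← Finset.sum_add_distrib]
      exact Finset.sum_congr rfl fun k _ => by ring
    have e2 : ∑ k, w k * (u * f k + v * g k) =
        u * ∑ k, w k * f k + v * ∑ k, w k * g k := by
      simp only [Finset.mul_sum, ← Finset.sum_add_distrib]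
      exact Finset.sum_congr rfl fun k _ => by ring
    rw [e1, e2]
    field_simp
    ring
  have h := det_le_det_of_quadratic_le (a' := (t + scatter α f f) / N)
    (b' := scatter α f g / N) (c' := (t + scatter α g g) / N)
    (fun u v => by
      rw [hform]
      have := weighted_sq_le hw0 (fun k => u * f k + v * g k)
      exact div_nonneg (by linarith) (by positivity))
    (fun u v => by
      rw [hform]
      have h1 := weighted_le_mul_scatter hα hw0 hw1 (fun k => u * f k + v * g k)
      rw [scatter_add_mul] at h1
      have e : u ^ 2 * ((t + scatter α f f) / N) + 2 * u * v * (scatter α f g / N) +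
          v ^ 2 * ((t + scatter α g g) / N) =
          (N * (u ^ 2 * scatter α f f + 2 * u * v * scatter α f g + v ^ 2 * scatter α g g) +
            N * t * (u ^ 2 + v ^ 2)) / N ^ 2 := by
        field_simp
        ring
      rw [e]
      gcongr
      have : 0 ≤ N * t * (u ^ 2 + v ^ 2) := by positivity
      linarith)
  refine h.trans (le_of_eq ?_)
  field_simp

/-! ### Expected scatter under independent sampling -/

theorem memLp_eval {X : Type*} [MeasurableSpace X] {P : Measure X} [IsProbabilityMeasure P]
    {f : X → ℝ} (hf : MemLp f 2 P) {N : ℕ} (k : Fin N) :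
    MemLp (fun x : Fin N → X => f (x k)) 2 (Measure.pi fun _ => P) :=
  hf.comp_measurePreserving (measurePreserving_eval (fun _ : Fin N => P) k)

theorem memLp_sum {X : Type*} [MeasurableSpace X] {P : Measure X} [IsProbabilityMeasure P]
    {f : X → ℝ} (hf : MemLp f 2 P) (N : ℕ) :
    MemLp (fun x : Fin N → X => ∑ k, f (x k)) 2 (Measure.pi fun _ => P) :=
  memLp_finsetSum _ fun k _ => memLp_eval hf k

theorem integrable_sum_eval {X : Type*} [MeasurableSpace X] {P : Measure X}
    [IsProbabilityMeasure P] {f : X → ℝ} (hf : Integrable f P) (N : ℕ) :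
    Integrable (fun x : Fin N → X => ∑ k, f (x k)) (Measure.pi fun _ => P) :=
  integrable_finsetSum _ fun _ _ => integrable_comp_eval hf

theorem integral_sum_eval {X : Type*} [MeasurableSpace X] {P : Measure X}
    [IsProbabilityMeasure P] {f : X → ℝ} (hf : Integrable f P) (N : ℕ) :
    ∫ x : Fin N → X, ∑ k, f (x k) ∂(Measure.pi fun _ => P) = N * ∫ y, f y ∂P := by
  rw [integral_finsetSum _ fun k _ => integrable_comp_eval hf]
  have h : ∀ k : Fin N, ∫ x : Fin N → X, f (x k) ∂(Measure.pi fun _ => P) = ∫ y, f y ∂P :=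
    fun k => integral_comp_eval (μ := fun _ : Fin N => P) hf.aestronglyMeasurable
  simp [h]

theorem variance_sum_eval {X : Type*} [MeasurableSpace X] {P : Measure X}
    [IsProbabilityMeasure P] {f : X → ℝ} (hf : MemLp f 2 P) (N : ℕ) :
    Var[fun x : Fin N → X => ∑ k, f (x k); Measure.pi fun _ => P] = N * Var[f; P] := by
  have h := variance_sum_pi (μ := fun _ : Fin N => P) (X := fun _ => f) fun _ => hf
  have e : (∑ k : Fin N, fun x : Fin N → X => f (x k)) = fun x => ∑ k, f (x k) := by
    ext x
    simp
  rw [e] at h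
  simp [h]

theorem integrable_scatter_self {X : Type*} [MeasurableSpace X] {P : Measure X}
    [IsProbabilityMeasure P] {f : X → ℝ} (hf : MemLp f 2 P) (α : ℝ) (N : ℕ) :
    Integrable (fun x : Fin N → X => scatter α (fun k => f (x k)) (fun k => f (x k)))
      (Measure.pi fun _ => P) := by
  have h1 : Integrable (fun y => f y * f y) P := hf.integrable_mul hf
  have h2 := (memLp_sum hf N).integrable_mul (memLp_sum hf N)
  exact (integrable_sum_eval h1 N).sub (h2.div_const _)

theorem integral_scatter_self {X : Type*} [MeasurableSpace X] {P : Measure X}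
    [IsProbabilityMeasure P] {f : X → ℝ} (hf : MemLp f 2 P) (α : ℝ) (N : ℕ) :
    ∫ x : Fin N → X, scatter α (fun k => f (x k)) (fun k => f (x k)) ∂(Measure.pi fun _ => P) =
      N * ∫ y, f y * f y ∂P - (N * Var[f; P] + (N * ∫ y, f y ∂P) ^ 2) / (α + N) := by
  have h1 : Integrable (fun y => f y * f y) P := hf.integrable_mul hf
  have h2 : Integrable (fun x : Fin N → X => (∑ k, f (x k)) * ∑ k, f (x k))
    (Measure.pi fun _ => P) := (memLp_sum hf N).integrable_mul (memLp_sum hf N)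
  have h3 := variance_eq_sub (memLp_sum hf N)
  rw [variance_sum_eval hf, integral_sum_eval (hf.integrable one_le_two)] at h3
  simp only [scatter]
  rw [integral_sub (integrable_sum_eval h1 N) (h2.div_const _), integral_sum_eval h1,
    integral_div]
  congr 2
  simp only [sq, Pi.mul_def] at h3 ⊢
  linarith

theorem tendsto_integral_scatter_self {X : Type*} [MeasurableSpace X] {P : Measure X}
    [IsProbabilityMeasure P] {f : X → ℝ} (hf : MemLp f 2 P) {α : ℝ} (hα : 0 < α) :
    Filter.Tendsto (fun N : ℕ => (∫ x : Fin N → X,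
        scatter α (fun k => f (x k)) (fun k => f (x k)) ∂(Measure.pi fun _ => P)) / N)
      Filter.atTop (nhds Var[f; P]) := by
  have hinv : Filter.Tendsto (fun N : ℕ => (α + N)⁻¹) Filter.atTop (nhds 0) :=
    (Filter.tendsto_atTop_add_const_left _ _ tendsto_natCast_atTop_atTop).inv_tendsto_atTop
  have hvar := variance_eq_sub hf
  have hlim : Filter.Tendsto (fun N : ℕ => ∫ y, f y * f y ∂P - (Var[f; P] * (α + N)⁻¹ +
      (∫ y, f y ∂P) ^ 2 * (1 - α * (α + N)⁻¹))) Filter.atTop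
      (nhds (∫ y, f y * f y ∂P - (Var[f; P] * 0 + (∫ y, f y ∂P) ^ 2 * (1 - α * 0)))) :=
    ((hinv.const_mul _).add (((hinv.const_mul α).const_sub 1).const_mul _)).const_sub _
  have e : ∫ y, f y * f y ∂P - (Var[f; P] * 0 + (∫ y, f y ∂P) ^ 2 * (1 - α * 0)) =
      Var[f; P] := by
    simp only [sq, Pi.mul_def] at hvar ⊢
    linarith
  rw [e] at hlim
  refine hlim.congr' ?_
  filter_upwards [Filter.eventually_gt_atTop 0] with N hN
  have hN' : (0 : ℝ) < N := by exact_mod_cast hN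
  rw [integral_scatter_self hf]
  field_simp
  ring

/-- Carries integrability and limits from diagonal entries to mixed ones. -/
theorem scatter_polarization (α : ℝ) {N : ℕ} (f g : Fin N → ℝ) :
    scatter α f g = (scatter α (fun k => f k + g k) (fun k => f k + g k) -
      scatter α f f - scatter α g g) / 2 := by
  have h := scatter_add_mul α f g 1 1
  simp only [one_mul] at h
  rw [h]
  ring

theorem integrable_scatter {X : Type*} [MeasurableSpace X] {P : Measure X}
    [IsProbabilityMeasure P] {f g : X → ℝ} (hf : MemLp f 2 P) (hg : MemLp g 2 P) (α : ℝ)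
    (N : ℕ) :
    Integrable (fun x : Fin N → X => scatter α (fun k => f (x k)) (fun k => g (x k)))
      (Measure.pi fun _ => P) := by
  refine ((((integrable_scatter_self (hf.add hg) α N).sub (integrable_scatter_self hf α N)).sub
    (integrable_scatter_self hg α N)).div_const 2).congr (Filter.Eventually.of_forall fun x => ?_)
  exact (scatter_polarization α _ _).symm

theorem tendsto_integral_scatter {X : Type*} [MeasurableSpace X] {P : Measure X}
    [IsProbabilityMeasure P] {f g : X → ℝ} (hf : MemLp f 2 P) (hg : MemLp g 2 P) {α : ℝ}
    (hα : 0 < α) :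
    Filter.Tendsto (fun N : ℕ => (∫ x : Fin N → X,
        scatter α (fun k => f (x k)) (fun k => g (x k)) ∂(Measure.pi fun _ => P)) / N)
      Filter.atTop (nhds cov[f, g; P]) := by
  have h := (((tendsto_integral_scatter_self (hf.add hg) hα).sub
    (tendsto_integral_scatter_self hf hα)).sub (tendsto_integral_scatter_self hg hα)).div_const 2
  rw [variance_add hf hg, show (Var[f; P] + 2 * cov[f, g; P] + Var[g; P] - Var[f; P] -
    Var[g; P]) / 2 = cov[f, g; P] by ring] at h
  refine h.congr fun N => ?_
  have e : ∀ x : Fin N → X, scatter α (fun k => f (x k)) (fun k => g (x k)) =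
      (scatter α (fun k => (f + g) (x k)) (fun k => (f + g) (x k)) -
      scatter α (fun k => f (x k)) (fun k => f (x k)) -
      scatter α (fun k => g (x k)) (fun k => g (x k))) / 2 :=
    fun x => scatter_polarization α _ _
  simp_rw [e]
  have hsub : Integrable (fun x : Fin N → X =>
      scatter α (fun k => (f + g) (x k)) (fun k => (f + g) (x k)) -
        scatter α (fun k => f (x k)) (fun k => f (x k))) (Measure.pi fun _ => P) :=
    (integrable_scatter_self (hf.add hg) α N).sub (integrable_scatter_self hf α N)
  rw [integral_div, integral_sub hsub (integrable_scatter_self hg α N),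
    integral_sub (integrable_scatter_self (hf.add hg) α N) (integrable_scatter_self hf α N)]
  ring

/-! ### Weak laws with rate and lower bounds for expectations -/

/-- A weak law of large numbers with rate `1 / N` for a continuous function of finitely many
empirical means. -/
theorem exists_measureReal_empirical_le {X : Type*} [MeasurableSpace X] {P : Measure X}
    [IsProbabilityMeasure P] {ι : Type*} [Fintype ι] {h : ι → X → ℝ} (hh : ∀ i, MemLp (h i) 2 P)
    {Φ : (ι → ℝ) → ℝ} (hΦ : Continuous Φ) {c : ℝ} (hc : c < Φ fun i => ∫ y, h i y ∂P) :
    ∃ C : ℝ, 0 ≤ C ∧ ∀ N : ℕ, 0 < N → (Measure.pi fun _ : Fin N => P).real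
      {x | Φ (fun i => (∑ k, h i (x k)) / N) ≤ c} ≤ C / N := by
  -- Continuity gives a sup-norm ball on which `Φ` exceeds `c`. Outside it some empirical mean
  -- deviates by at least `ε`: a union bound and Chebyshev finish.
  obtain ⟨ε, hε, hball⟩ := Metric.eventually_nhds_iff.1
    (hΦ.continuousAt.eventually (lt_mem_nhds hc))
  refine ⟨∑ i, Var[h i; P] / ε ^ 2, Finset.sum_nonneg fun i _ =>
    div_nonneg (variance_nonneg _ _) (sq_nonneg _), fun N hN => ?_⟩
  have hN' : (0 : ℝ) < N := by exact_mod_cast hN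
  have hsub : {x : Fin N → X | Φ (fun i => (∑ k, h i (x k)) / N) ≤ c} ⊆
      ⋃ i, {x | N * ε ≤ |∑ k, h i (x k) -
        ∫ x : Fin N → X, ∑ k, h i (x k) ∂(Measure.pi fun _ => P)|} := by
    intro x hx
    by_contra hcon
    simp only [Set.mem_iUnion, Set.mem_ofPred_eq, not_exists, not_le] at hcon hx
    refine (hball ((dist_pi_lt_iff hε).2 fun i => ?_)).not_ge hx
    have hi := hcon i
    rw [integral_sum_eval ((hh i).integrable one_le_two)] at hi
    rw [Real.dist_eq, show (∑ k, h i (x k)) / N - ∫ y, h i y ∂P =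
      (∑ k, h i (x k) - N * ∫ y, h i y ∂P) / N by field_simp, abs_div, abs_of_pos hN',
      div_lt_iff₀ hN']
    linarith
  calc (Measure.pi fun _ : Fin N => P).real {x | Φ (fun i => (∑ k, h i (x k)) / N) ≤ c}
      ≤ (Measure.pi fun _ : Fin N => P).real (⋃ i, {x | N * ε ≤ |∑ k, h i (x k) -
        ∫ x : Fin N → X, ∑ k, h i (x k) ∂(Measure.pi fun _ => P)|}) := measureReal_mono hsub
    _ ≤ ∑ i, (Measure.pi fun _ : Fin N => P).real {x | N * ε ≤ |∑ k, h i (x k) -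
        ∫ x : Fin N → X, ∑ k, h i (x k) ∂(Measure.pi fun _ => P)|} :=
      measureReal_iUnion_fintype_le _
    _ ≤ ∑ i, Var[h i; P] / ε ^ 2 / N := by
      refine Finset.sum_le_sum fun i _ => ?_
      have hch := meas_ge_le_variance_div_sq (memLp_sum (hh i) N) (c := N * ε) (by positivity)
      rw [variance_sum_eval (hh i)] at hch
      refine (ENNReal.toReal_le_of_le_ofReal (div_nonneg (mul_nonneg hN'.le
        (variance_nonneg _ _)) (sq_nonneg _)) hch).trans (le_of_eq ?_)
      field_simp
    _ = (∑ i, Var[h i; P] / ε ^ 2) / N := by rw [Finset.sum_div]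

/-- If `L N` is at least `-(A log N + B)` and is below `ℓ` with probability `O(1 / N)`, then its
expectation is eventually above every number less than `ℓ`. -/
theorem eventually_lt_integral_of_measureReal_lt {Ω : ℕ → Type*} [∀ N, MeasurableSpace (Ω N)]
    {ρ : ∀ N, Measure (Ω N)} [∀ N, IsProbabilityMeasure (ρ N)] {L : ∀ N, Ω N → ℝ}
    (hLm : ∀ N, Measurable (L N))
    (hL : ∀ N, Integrable (L N) (ρ N)) {A B ℓ C : ℝ} (hA : 0 ≤ A) (hB : 0 ≤ B)
    (hlow : ∀ N : ℕ, 0 < N → ∀ x, -(A * Real.log N + B) ≤ L N x)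
    (hprob : ∀ N : ℕ, 0 < N → (ρ N).real {x | L N x < ℓ} ≤ C / N) {m : ℝ} (hm : m < ℓ) :
    ∀ᶠ N in Filter.atTop, m < ∫ x, L N x ∂(ρ N) := by
  have hlim : Filter.Tendsto (fun N : ℕ => ℓ - (A * (Real.log N / N) +
      (|ℓ| + B) * (N : ℝ)⁻¹) * C) Filter.atTop (nhds (ℓ - (A * 0 + (|ℓ| + B) * 0) * C)) :=
    (((tendsto_log_natCast_div.const_mul A).add
      ((tendsto_inv_atTop_nhds_zero_nat (𝕜 := ℝ)).const_mul _)).mul_const C).const_sub ℓ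
  rw [show ℓ - (A * 0 + (|ℓ| + B) * 0) * C = ℓ by ring] at hlim
  filter_upwards [hlim.eventually (lt_mem_nhds hm), Filter.eventually_gt_atTop 0] with N h1 hN
  refine h1.trans_le ?_
  have hN' : (0 : ℝ) < N := by exact_mod_cast hN
  have hlog : 0 ≤ Real.log N := Real.log_natCast_nonneg N
  have hset : MeasurableSet {x | L N x < ℓ} := measurableSet_lt (hLm N) measurable_const
  set D := |ℓ| + A * Real.log N + B with hD
  have hD0 : 0 ≤ D := by positivity
  -- `D` is the largest possible shortfall below `ℓ`. It grows like `log N`, while the event has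
  -- probability at most `C / N`.
  have hpt : ∀ x, ℓ - Set.indicator {x | L N x < ℓ} (fun _ => D) x ≤ L N x := by
    intro x
    by_cases hx : L N x < ℓ
    · rw [Set.indicator_of_mem (by simpa using hx)]
      have := hlow N hN x
      have := le_abs_self ℓ
      linarith
    · rw [Set.indicator_of_notMem (by simpa using hx)]
      linarith
  have hind : Integrable (Set.indicator {x | L N x < ℓ} fun _ => D) (ρ N) :=
    (integrable_const D).indicator hset
  have hint := integral_mono ((integrable_const ℓ).sub hind) (hL N) hpt
  simp only [Pi.sub_apply] at hint
  rw [integral_sub (integrable_const ℓ) hind, integral_indicator_const _ hset] at hint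
  simp only [integral_const, probReal_univ, smul_eq_mul, one_mul] at hint
  have h3 : (ρ N).real {x | L N x < ℓ} * D ≤ C / N * D :=
    mul_le_mul_of_nonneg_right (hprob N hN) hD0
  have h4 : C / N * D = (A * (Real.log N / N) + (|ℓ| + B) * (N : ℝ)⁻¹) * C := by
    rw [hD]
    field_simp
    ring
  linarith

/-- The monomials of degree at most two in two functions. -/
def monomials {X : Type*} (f g : X → ℝ) : Fin 6 → X → ℝ :=
  ![fun _ => 1, f, g, fun y => f y * f y, fun y => f y * g y, fun y => g y * g y]

theorem measurable_monomials {X : Type*} [MeasurableSpace X] {f g : X → ℝ} (hf : Measurable f)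
    (hg : Measurable g) (i : Fin 6) : Measurable (monomials f g i) := by
  fin_cases i
  · exact measurable_const
  · exact hf
  · exact hg
  · exact hf.mul hf
  · exact hf.mul hg
  · exact hg.mul hg

theorem integrable_monomials {X : Type*} [MeasurableSpace X] {P : Measure X}
    [IsProbabilityMeasure P] {f g : X → ℝ} (hf : MemLp f 2 P) (hg : MemLp g 2 P) (i : Fin 6) :
    Integrable (monomials f g i) P := by
  fin_cases i
  · exact integrable_const 1
  · exact hf.integrable one_le_two
  · exact hg.integrable one_le_two
  · exact hf.integrable_mul hf
  · exact hf.integrable_mul hg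
  · exact hg.integrable_mul hg

theorem abs_monomials_le {X : Type*} {f g : X → ℝ} {y : X} {R : ℝ} (hR : 1 ≤ R)
    (hf : |f y| ≤ R) (hg : |g y| ≤ R) (i : Fin 6) : |monomials f g i y| ≤ R * R := by
  have hR' : R ≤ R * R := by nlinarith
  have h0 : 0 ≤ R := by linarith
  fin_cases i
  · simpa [monomials] using hR.trans hR'
  · exact hf.trans hR'
  · exact hg.trans hR'
  · simpa [monomials] using mul_le_mul hf hf (abs_nonneg _) h0
  · simpa [monomials, abs_mul] using mul_le_mul hf hg (abs_nonneg _) h0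
  · simpa [monomials] using mul_le_mul hg hg (abs_nonneg _) h0

/-- After truncation by a weight with values in `[0, 1]`, the empirical moments of degree at most
two obey a law of large numbers with rate `1 / N`, with limit close to the true moments. -/
theorem exists_weight_measureReal_empirical_le {X : Type*} [MeasurableSpace X] {P : Measure X}
    [IsProbabilityMeasure P] {f g : X → ℝ} (hfm : Measurable f) (hgm : Measurable g)
    (hf : MemLp f 2 P) (hg : MemLp g 2 P) {Φ : (Fin 6 → ℝ) → ℝ} (hΦ : Continuous Φ) {c : ℝ}
    (hc : c < Φ fun i => ∫ y, monomials f g i y ∂P) :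
    ∃ w : X → ℝ, (∀ y, 0 ≤ w y) ∧ (∀ y, w y ≤ 1) ∧ ∃ C : ℝ, 0 ≤ C ∧ ∀ N : ℕ, 0 < N →
      (Measure.pi fun _ : Fin N => P).real
        {x | Φ (fun i => (∑ k, w (x k) * monomials f g i (x k)) / N) ≤ c} ≤ C / N := by
  -- The quadratic monomials are only integrable, so Chebyshev does not apply to them directly.
  -- Restricted to `S n` they are bounded, and by dominated convergence some `n` keeps `Φ` of the
  -- truncated moments above `c`.
  let S : ℕ → Set X := fun n => {y | |f y| ≤ n + 1 ∧ |g y| ≤ n + 1}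
  have hS : ∀ n, MeasurableSet (S n) := fun n =>
    (measurableSet_le hfm.abs measurable_const).inter (measurableSet_le hgm.abs measurable_const)
  let w : ℕ → X → ℝ := fun n => (S n).indicator fun _ => 1
  have hw0 : ∀ n y, 0 ≤ w n y := fun n y => Set.indicator_nonneg (fun _ _ => zero_le_one) y
  have hw1 : ∀ n y, w n y ≤ 1 := fun n y => Set.indicator_le_self' (fun _ _ => zero_le_one) y
  have hwm : ∀ n, Measurable (w n) := fun n => measurable_const.indicator (hS n)
  have hmeas : ∀ n i, Measurable fun y => w n y * monomials f g i y :=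
    fun n i => (hwm n).mul (measurable_monomials hfm hgm i)
  have hlim : Filter.Tendsto (fun n : ℕ => fun i => ∫ y, w n y * monomials f g i y ∂P)
      Filter.atTop (nhds fun i => ∫ y, monomials f g i y ∂P) := by
    refine tendsto_pi_nhds.2 fun i => ?_
    refine tendsto_integral_of_dominated_convergence (fun y => |monomials f g i y|)
      (fun n => (hmeas n i).aestronglyMeasurable) (integrable_monomials hf hg i).abs
      (fun n => Filter.Eventually.of_forall fun y => ?_)
      (Filter.Eventually.of_forall fun y => ?_)
    · rw [Real.norm_eq_abs, abs_mul, abs_of_nonneg (hw0 n y)]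
      exact mul_le_of_le_one_left (abs_nonneg _) (hw1 n y)
    · refine tendsto_const_nhds.congr' ?_
      filter_upwards [Filter.eventually_ge_atTop ⌈max |f y| |g y|⌉₊] with n hn
      have h1 : max |f y| |g y| ≤ n := (Nat.le_ceil _).trans (by exact_mod_cast hn)
      have h2 : y ∈ S n := ⟨by linarith [le_max_left |f y| |g y|],
        by linarith [le_max_right |f y| |g y|]⟩
      have h3 : w n y = 1 := Set.indicator_of_mem h2 _
      rw [h3, one_mul]
  obtain ⟨n, hn⟩ := ((hΦ.tendsto _).comp hlim |>.eventually (lt_mem_nhds hc)).exists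
  have hL2 : ∀ i, MemLp (fun y => w n y * monomials f g i y) 2 P := by
    intro i
    refine MemLp.of_bound (hmeas n i).aestronglyMeasurable (((n : ℝ) + 1) * (n + 1))
      (Filter.Eventually.of_forall fun y => ?_)
    by_cases hy : y ∈ S n
    · have h3 : w n y = 1 := Set.indicator_of_mem hy _
      rw [h3, one_mul]
      exact abs_monomials_le (by simp) hy.1 hy.2 i
    · have h3 : w n y = 0 := Set.indicator_of_notMem hy _
      rw [h3, zero_mul, norm_zero]
      positivity
  exact ⟨w n, hw0 n, hw1 n, exists_measureReal_empirical_le hL2 hΦ hn⟩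

/-! ### Limits of the expected logarithms -/

theorem measurable_scatter {X : Type*} [MeasurableSpace X] {f g : X → ℝ} (hf : Measurable f)
    (hg : Measurable g) (α : ℝ) (N : ℕ) :
    Measurable fun x : Fin N → X => scatter α (fun k => f (x k)) (fun k => g (x k)) := by
  have hf' : ∀ k, Measurable fun x : Fin N → X => f (x k) :=
    fun k => hf.comp (measurable_pi_apply k)
  have hg' : ∀ k, Measurable fun x : Fin N → X => g (x k) :=
    fun k => hg.comp (measurable_pi_apply k)
  unfold scatter
  fun_prop

theorem integrable_log_scatter {X : Type*} [MeasurableSpace X] {P : Measure X}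
    [IsProbabilityMeasure P] {f : X → ℝ} (hfm : Measurable f) (hf : MemLp f 2 P) {α t : ℝ}
    (hα : 0 < α) (ht : 0 < t) (N : ℕ) :
    Integrable (fun x : Fin N → X => Real.log (t + scatter α (fun k => f (x k)) fun k => f (x k)))
      (Measure.pi fun _ => P) := by
  refine Integrable.mono' ((integrable_const (|Real.log t| + t)).add
    (integrable_scatter_self hf α N))
    (Real.measurable_log.comp
      ((measurable_scatter hfm hfm α N).const_add t)).aestronglyMeasurable
    (Filter.Eventually.of_forall fun x => ?_)
  have h0 := scatter_nonneg hα fun k => f (x k)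
  have h1 := Real.log_le_sub_one_of_pos
    (show 0 < t + scatter α (fun k => f (x k)) (fun k => f (x k)) by linarith)
  have h2 := Real.log_le_log ht
    (show t ≤ t + scatter α (fun k => f (x k)) (fun k => f (x k)) by linarith)
  have h3 := neg_abs_le (Real.log t)
  have h4 := abs_nonneg (Real.log t)
  simp only [Pi.add_apply]
  rw [Real.norm_eq_abs, abs_le]
  constructor <;> linarith

/-- From above the determinant is at most the product of the diagonal entries, and `log z ≤ z - 1`;
from below it is at least `t ^ 2`. -/
theorem integrable_log_det {X : Type*} [MeasurableSpace X] {P : Measure X}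
    [IsProbabilityMeasure P] {f g : X → ℝ} (hfm : Measurable f) (hgm : Measurable g)
    (hf : MemLp f 2 P) (hg : MemLp g 2 P) {α t : ℝ} (hα : 0 < α) (ht : 0 < t) (N : ℕ) :
    Integrable (fun x : Fin N → X => Real.log
      ((t + scatter α (fun k => f (x k)) fun k => f (x k)) *
        (t + scatter α (fun k => g (x k)) fun k => g (x k)) -
        scatter α (fun k => f (x k)) (fun k => g (x k)) ^ 2)) (Measure.pi fun _ => P) := by
  have hff := measurable_scatter hfm hfm α N
  have hgg := measurable_scatter hgm hgm α N
  have hfg := measurable_scatter hfm hgm α N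
  refine Integrable.mono' (((integrable_const (2 * |Real.log t| + 2 * t)).add
    (integrable_scatter_self hf α N)).add (integrable_scatter_self hg α N))
    (Real.measurable_log.comp (by fun_prop)).aestronglyMeasurable
    (Filter.Eventually.of_forall fun x => ?_)
  simp only [Pi.add_apply]
  have hf0 := scatter_nonneg hα fun k => f (x k)
  have hg0 := scatter_nonneg hα fun k => g (x k)
  have hdet := sq_le_scatter_det hα ht (fun k => f (x k)) (fun k => g (x k))
  set A := scatter α (fun k => f (x k)) fun k => f (x k)
  set B := scatter α (fun k => g (x k)) fun k => g (x k)
  set C := scatter α (fun k => f (x k)) fun k => g (x k)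
  have hpos : 0 < (t + A) * (t + B) - C ^ 2 := (by positivity : 0 < t ^ 2).trans_le hdet
  have h1 := Real.log_le_sub_one_of_pos (show 0 < t + A by linarith)
  have h2 := Real.log_le_sub_one_of_pos (show 0 < t + B by linarith)
  have h3 := Real.log_le_log hpos
    (show (t + A) * (t + B) - C ^ 2 ≤ (t + A) * (t + B) by nlinarith [sq_nonneg C])
  rw [Real.log_mul (by positivity) (by positivity)] at h3
  have h4 := Real.log_le_log (by positivity) hdet
  rw [Real.log_pow] at h4
  push_cast at h4
  have h5 := neg_abs_le (Real.log t)
  have h6 := abs_nonneg (Real.log t)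
  rw [Real.norm_eq_abs, abs_le]
  constructor <;> linarith

theorem tendsto_integral_const_add_scatter {X : Type*} [MeasurableSpace X] {P : Measure X}
    [IsProbabilityMeasure P] {f : X → ℝ} (hf : MemLp f 2 P) {α : ℝ} (hα : 0 < α) (t : ℝ) :
    Filter.Tendsto (fun N : ℕ => (∫ x : Fin N → X,
        (t + scatter α (fun k => f (x k)) (fun k => f (x k))) ∂(Measure.pi fun _ => P)) / N)
      Filter.atTop (nhds Var[f; P]) := by
  have h := ((tendsto_inv_atTop_nhds_zero_nat (𝕜 := ℝ)).const_mul t).add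
    (tendsto_integral_scatter_self hf hα)
  rw [mul_zero, zero_add] at h
  refine h.congr fun N => ?_
  rw [integral_add (integrable_const t) (integrable_scatter_self hf α N)]
  simp only [integral_const, probReal_univ, smul_eq_mul, one_mul]
  ring

/-- The expected logarithm of a diagonal entry of the posterior scatter matrix. -/
theorem tendsto_integral_log_scatter {X : Type*} [MeasurableSpace X] {P : Measure X}
    [IsProbabilityMeasure P] {f : X → ℝ} (hfm : Measurable f) (hf : MemLp f 2 P) {α t : ℝ}
    (hα : 0 < α) (ht : 0 < t) (hV : 0 < Var[f; P]) :
    Filter.Tendsto (fun N : ℕ => ∫ x : Fin N → X,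
        (Real.log (t + scatter α (fun k => f (x k)) fun k => f (x k)) - Real.log N)
        ∂(Measure.pi fun _ => P))
      Filter.atTop (nhds (Real.log Var[f; P])) := by
  have hint : ∀ N : ℕ, Integrable (fun x : Fin N → X =>
      Real.log (t + scatter α (fun k => f (x k)) fun k => f (x k)) - Real.log N)
      (Measure.pi fun _ => P) := fun N =>
    (integrable_log_scatter hfm hf hα ht N).sub (integrable_const _)
  rw [tendsto_order]
  constructor
  · intro m hm
    obtain ⟨ℓ, hmℓ, hℓ⟩ := exists_between hm
    have hexp : Real.exp ℓ < Var[f; P] := (Real.lt_log_iff_exp_lt hV).1 hℓ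
    -- Indices 0, 1, 3 stand for the monomials 1, `f`, `f ^ 2`, so `Φ` is the weighted variance form
    -- and equals `Var[f; P]` at the true moments.
    obtain ⟨w, hw0, hw1, C, -, hC⟩ := exists_weight_measureReal_empirical_le hfm hfm hf hf
      (Φ := fun m => m 0 * m 3 - m 1 ^ 2) (by fun_prop) (c := Real.exp ℓ) (by
        have hv := variance_eq_sub hf
        simp only [sq, Pi.mul_def] at hv
        simp only [monomials, Matrix.cons_val, integral_const, probReal_univ, smul_eq_mul, one_mul]
        rw [sq]
        linarith)
    refine eventually_lt_integral_of_measureReal_lt (A := 1) (B := |Real.log t|) (C := C)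
      (fun N => ?_) hint zero_le_one
      (abs_nonneg _) (fun N hN x => ?_) (fun N hN => (measureReal_mono ?_).trans (hC N hN)) hmℓ
    · have := measurable_scatter hfm hfm α N
      fun_prop
    · have h2 := Real.log_le_log ht
        (show t ≤ t + scatter α (fun k => f (x k)) (fun k => f (x k)) by
          linarith [scatter_nonneg hα fun k => f (x k)])
      have h3 := neg_abs_le (Real.log t)
      linarith
    · intro x hx
      have hN' : (0 : ℝ) < N := by exact_mod_cast hN
      have h0 := scatter_nonneg hα fun k => f (x k)
      simp only [Set.mem_ofPred_eq] at hx ⊢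
      rw [← Real.log_div (by positivity) (by positivity),
        Real.log_lt_iff_lt_exp (by positivity)] at hx
      refine le_trans ?_ hx.le
      have hwt := weighted_le_mul_scatter hα (fun k => hw0 (x k)) (fun k => hw1 (x k))
        fun k => f (x k)
      simp only [monomials, Matrix.cons_val, mul_one, ← mul_assoc]
      rw [div_mul_div_comm, div_pow, ← sq, ← sub_div, div_le_div_iff₀ (by positivity) hN']
      nlinarith [mul_pos hN' ht, mul_pos hN' (mul_pos hN' ht)]
  · intro m hm
    set V := Var[f; P] with hVdef
    -- Expectation of the tangent line to log at `N * V`, which bounds the logarithm from above.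
    have hlim := (((tendsto_integral_const_add_scatter hf hα t).div_const V).sub_const 1).const_add
      (Real.log V)
    rw [← hVdef, div_self hV.ne', sub_self, add_zero] at hlim
    filter_upwards [hlim.eventually (gt_mem_nhds hm), Filter.eventually_gt_atTop 0] with N h1 hN
    refine lt_of_le_of_lt ?_ h1
    have hN' : (0 : ℝ) < N := by exact_mod_cast hN
    have hTint : Integrable (fun x : Fin N → X =>
        t + scatter α (fun k => f (x k)) fun k => f (x k)) (Measure.pi fun _ => P) :=
      (integrable_const t).add (integrable_scatter_self hf α N)
    have hquot : Integrable (fun x : Fin N → X =>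
        (t + scatter α (fun k => f (x k)) fun k => f (x k)) / (N * V) - 1)
        (Measure.pi fun _ => P) := (hTint.div_const _).sub (integrable_const 1)
    have hmono := integral_mono (hint N) ((integrable_const (Real.log V)).add hquot) fun x => by
      have h0 := scatter_nonneg hα fun k => f (x k)
      have hl := Real.log_le_sub_one_of_pos
        (show 0 < (t + scatter α (fun k => f (x k)) fun k => f (x k)) / (N * V) by positivity)
      rw [Real.log_div (by positivity) (by positivity),
        Real.log_mul (by positivity) (by positivity)] at hl
      simp only [Pi.add_apply]
      linarith
    refine hmono.trans (le_of_eq ?_)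
    simp only [Pi.add_apply]
    rw [integral_add (integrable_const _) hquot,
      integral_sub (hTint.div_const _) (integrable_const 1), integral_div]
    simp only [integral_const, probReal_univ, smul_eq_mul, one_mul]
    field_simp

/-- The tangent-line bound for the concave function `log det` on positive definite `2 × 2`
matrices. -/
theorem log_det_le {a b d p q r : ℝ} (ha : 0 < a) (hT : 0 < a * d - b ^ 2) (hp : 0 < p)
    (hS : 0 < p * r - q ^ 2) :
    Real.log (a * d - b ^ 2) ≤ Real.log (p * r - q ^ 2) +
      (a * r + d * p - 2 * b * q) / (p * r - q ^ 2) - 2 := by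
  set T := a * d - b ^ 2 with hTdef
  set S := p * r - q ^ 2 with hSdef
  set τ := a * r + d * p - 2 * b * q with hτdef
  -- The polynomial `T - z * τ + z ^ 2 * S` is the determinant of the first matrix minus `z` times
  -- the second. At `z = a / p` the top left entry vanishes, so the value is minus a square; hence
  -- the discriminant `τ ^ 2 - 4 * T * S` is nonnegative.
  have hl : 0 < a / p := by positivity
  have hle : T - a / p * τ + (a / p) ^ 2 * S ≤ 0 := by
    have : T - a / p * τ + (a / p) ^ 2 * S = -(b - a / p * q) ^ 2 := by
      rw [hTdef, hSdef, hτdef]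
      field_simp
      ring
    rw [this]
    nlinarith [sq_nonneg (b - a / p * q)]
  have hτ : 0 < τ := by
    by_contra hcon
    have h1 : a / p * τ ≤ 0 := mul_nonpos_of_nonneg_of_nonpos hl.le (not_lt.1 hcon)
    have h2 : 0 < (a / p) ^ 2 * S := by positivity
    linarith
  have hdisc : T / S ≤ (τ / (2 * S)) ^ 2 := by
    have h4 : 4 * T * S ≤ τ ^ 2 := by
      have h5 : S * (T - a / p * τ + (a / p) ^ 2 * S) ≤ 0 :=
        mul_nonpos_of_nonneg_of_nonpos hS.le hle
      nlinarith [sq_nonneg (τ - 2 * (a / p) * S)]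
    rw [div_pow, div_le_div_iff₀ hS (by positivity)]
    nlinarith [mul_le_mul_of_nonneg_left h4 hS.le]
  have h1 := Real.log_le_log (by positivity) hdisc
  rw [Real.log_pow, Real.log_div hT.ne' hS.ne'] at h1
  push_cast at h1
  have h2 := Real.log_le_sub_one_of_pos (show 0 < τ / (2 * S) by positivity)
  have h3 : τ / S = 2 * (τ / (2 * S)) := by field_simp
  rw [h3]
  linarith

/-- The expected logarithm of the determinant of the posterior scatter matrix. -/
theorem tendsto_integral_log_det {X : Type*} [MeasurableSpace X] {P : Measure X}
    [IsProbabilityMeasure P] {f g : X → ℝ} (hfm : Measurable f) (hgm : Measurable g)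
    (hf : MemLp f 2 P) (hg : MemLp g 2 P) {α t : ℝ} (hα : 0 < α) (ht : 0 < t)
    (hV : 0 < Var[f; P]) (hD : 0 < Var[f; P] * Var[g; P] - cov[f, g; P] ^ 2) :
    Filter.Tendsto (fun N : ℕ => ∫ x : Fin N → X,
        (Real.log ((t + scatter α (fun k => f (x k)) fun k => f (x k)) *
        (t + scatter α (fun k => g (x k)) fun k => g (x k)) -
        scatter α (fun k => f (x k)) (fun k => g (x k)) ^ 2) - 2 * Real.log N)
        ∂(Measure.pi fun _ => P))
      Filter.atTop (nhds (Real.log (Var[f; P] * Var[g; P] - cov[f, g; P] ^ 2))) := by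
  have hint : ∀ N : ℕ, Integrable (fun x : Fin N → X =>
      Real.log ((t + scatter α (fun k => f (x k)) fun k => f (x k)) *
        (t + scatter α (fun k => g (x k)) fun k => g (x k)) -
        scatter α (fun k => f (x k)) (fun k => g (x k)) ^ 2) - 2 * Real.log N)
      (Measure.pi fun _ => P) := fun N =>
    (integrable_log_det hfm hgm hf hg hα ht N).sub (integrable_const _)
  rw [tendsto_order]
  constructor
  · intro m hm
    obtain ⟨ℓ, hmℓ, hℓ⟩ := exists_between hm
    have hexp : Real.exp ℓ < Var[f; P] * Var[g; P] - cov[f, g; P] ^ 2 :=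
      (Real.lt_log_iff_exp_lt hD).1 hℓ
    -- `Φ` is the determinant of the weighted covariance matrix, the left side of `weighted_det_le`.
    obtain ⟨w, hw0, hw1, C, -, hC⟩ := exists_weight_measureReal_empirical_le hfm hgm hf hg
      (Φ := fun m => (m 0 * m 3 - m 1 ^ 2) * (m 0 * m 5 - m 2 ^ 2) - (m 0 * m 4 - m 1 * m 2) ^ 2)
      (by fun_prop) (c := Real.exp ℓ) (by
        have hvf := variance_eq_sub hf
        have hvg := variance_eq_sub hg
        have hc := covariance_eq_sub hf hg
        simp only [Pi.mul_def, Pi.pow_def] at hvf hvg hc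
        rw [hvf, hvg, hc] at hexp
        simpa [monomials, ← sq] using hexp)
    refine eventually_lt_integral_of_measureReal_lt (A := 2) (B := 2 * |Real.log t|) (C := C)
      (fun N => ?_) hint zero_le_two
      (by positivity) (fun N hN x => ?_) (fun N hN => (measureReal_mono ?_).trans (hC N hN)) hmℓ
    · have hff := measurable_scatter hfm hfm α N
      have hgg := measurable_scatter hgm hgm α N
      have hfg := measurable_scatter hfm hgm α N
      fun_prop
    · have h2 := Real.log_le_log (by positivity)
        (sq_le_scatter_det hα ht (fun k => f (x k)) (fun k => g (x k)))
      rw [Real.log_pow] at h2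
      push_cast at h2
      have h3 := neg_abs_le (Real.log t)
      linarith
    · intro x hx
      have hN' : (0 : ℝ) < N := by exact_mod_cast hN
      have hdet := sq_le_scatter_det hα ht (fun k => f (x k)) (fun k => g (x k))
      have hpos := (by positivity : 0 < t ^ 2).trans_le hdet
      have hlogN : 2 * Real.log N = Real.log ((N : ℝ) ^ 2) := by
        rw [Real.log_pow]
        norm_num
      simp only [Set.mem_ofPred_eq] at hx ⊢
      rw [hlogN, ← Real.log_div (by positivity) (by positivity),
        Real.log_lt_iff_lt_exp (by positivity)] at hx
      refine le_trans ?_ hx.le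
      have hwt := weighted_det_le hα ht hN (fun k => hw0 (x k)) (fun k => hw1 (x k))
        (fun k => f (x k)) fun k => g (x k)
      simpa only [monomials, Matrix.cons_val, mul_one, ← mul_assoc] using hwt
  · intro m hm
    set V := Var[f; P] with hVdef
    set U := Var[g; P] with hUdef
    set c := cov[f, g; P] with hcdef
    -- Expectation of the tangent bound `log_det_le` at `N` times the covariance matrix; its trace
    -- term tends to 2 and cancels the `-2`.
    have hlim := (((((tendsto_integral_const_add_scatter hf hα t).mul_const U).add
      ((tendsto_integral_const_add_scatter hg hα t).mul_const V)).sub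
      ((tendsto_integral_scatter hf hg hα).mul_const (2 * c))).div_const (V * U - c ^ 2)).const_add
      (Real.log (V * U - c ^ 2) - 2)
    rw [← hVdef, ← hUdef, ← hcdef, show V * U + U * V - c * (2 * c) = 2 * (V * U - c ^ 2) by ring,
      mul_div_assoc, div_self hD.ne', mul_one, sub_add_cancel] at hlim
    filter_upwards [hlim.eventually (gt_mem_nhds hm), Filter.eventually_gt_atTop 0] with N h1 hN
    refine lt_of_le_of_lt ?_ h1
    have hN' : (0 : ℝ) < N := by exact_mod_cast hN
    have hFint : Integrable (fun x : Fin N → X =>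
        t + scatter α (fun k => f (x k)) fun k => f (x k)) (Measure.pi fun _ => P) :=
      (integrable_const t).add (integrable_scatter_self hf α N)
    have hGint : Integrable (fun x : Fin N → X =>
        t + scatter α (fun k => g (x k)) fun k => g (x k)) (Measure.pi fun _ => P) :=
      (integrable_const t).add (integrable_scatter_self hg α N)
    have hFGint := integrable_scatter hf hg α N
    have hsum : Integrable (fun x : Fin N → X =>
        (t + scatter α (fun k => f (x k)) fun k => f (x k)) * U +
        (t + scatter α (fun k => g (x k)) fun k => g (x k)) * V) (Measure.pi fun _ => P) :=
      (hFint.mul_const U).add (hGint.mul_const V)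
    have hquot : Integrable (fun x : Fin N → X =>
        ((t + scatter α (fun k => f (x k)) fun k => f (x k)) * U +
        (t + scatter α (fun k => g (x k)) fun k => g (x k)) * V -
        scatter α (fun k => f (x k)) (fun k => g (x k)) * (2 * c)) / (N * (V * U - c ^ 2)))
        (Measure.pi fun _ => P) :=
      (hsum.sub (hFGint.mul_const _)).div_const _
    have hmono := integral_mono (hint N)
      ((integrable_const (Real.log (V * U - c ^ 2) - 2)).add hquot) fun x => by
      have h0 := scatter_nonneg hα fun k => f (x k)
      have hpos := (by positivity : 0 < t ^ 2).trans_le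
        (sq_le_scatter_det hα ht (fun k => f (x k)) (fun k => g (x k)))
      have hl := log_det_le (p := N * V) (q := N * c) (r := N * U)
        (show 0 < t + scatter α (fun k => f (x k)) fun k => f (x k) by linarith) hpos
        (by positivity) (by
          have : (N : ℝ) * V * (N * U) - (N * c) ^ 2 = N ^ 2 * (V * U - c ^ 2) := by ring
          rw [this]
          positivity)
      rw [show (N : ℝ) * V * (N * U) - (N * c) ^ 2 = N ^ 2 * (V * U - c ^ 2) by ring,
        Real.log_mul (by positivity) hD.ne', Real.log_pow] at hl
      push_cast at hl
      simp only [Pi.add_apply]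
      refine (sub_le_sub_right hl _).trans (le_of_eq ?_)
      field_simp
      ring
    refine hmono.trans (le_of_eq ?_)
    simp only [Pi.add_apply]
    rw [integral_add (integrable_const _) hquot, integral_div,
      integral_sub hsum (hFGint.mul_const _),
      integral_add (hFint.mul_const U) (hGint.mul_const V), integral_mul_const,
      integral_mul_const, integral_mul_const]
    simp only [integral_const, probReal_univ, smul_eq_mul, one_mul]
    field_simp

end BGe

end

/-! ### Assembly of the limit -/

theorem lemma2 (αμ αw t : ℝ) (hαμ : 0 < αμ) (hαw : 3 < αw) (ht : 0 < t)
    (p : BGe.DAG → ℝ) (hp : ∀ G, 0 ≤ p G)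
    (hp_sum : p .empty + p .oneToTwo + p .twoToOne = 1)
    (hp_empty : 0 < p .empty) (hp_edge : 0 < p .oneToTwo)
    (P : MeasureTheory.Measure (Fin 2 → ℝ)) [MeasureTheory.IsProbabilityMeasure P]
    (hP : ∀ i, MeasureTheory.MemLp (fun x : Fin 2 → ℝ => x i) 2 P)
    (hdet : BGe.covMatrix P 0 0 * BGe.covMatrix P 1 1 - BGe.covMatrix P 0 1 ^ 2 ≠ 0) :
    (∀ N : ℕ, MeasureTheory.Integrable
        (fun x : Fin N → Fin 2 → ℝ => BGe.logPosteriorRatio αμ αw t p x)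
        (MeasureTheory.Measure.pi fun _ : Fin N => P)) ∧
      Filter.Tendsto (fun N : ℕ => BGe.r10 αμ αw t p P N) Filter.atTop
        (nhds (1 / 2 * Real.log
          (BGe.covMatrix P 0 0 * BGe.covMatrix P 1 1 /
            (BGe.covMatrix P 0 0 * BGe.covMatrix P 1 1 - BGe.covMatrix P 0 1 ^ 2)))) := by
  have hm : ∀ i : Fin 2, Measurable fun x : Fin 2 → ℝ => x i := fun i => measurable_pi_apply i
  have h00 : BGe.covMatrix P 0 0 = Var[fun x : Fin 2 → ℝ => x 0; P] :=
    covariance_self (hm 0).aemeasurable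
  have h11 : BGe.covMatrix P 1 1 = Var[fun x : Fin 2 → ℝ => x 1; P] :=
    covariance_self (hm 1).aemeasurable
  have h01 : BGe.covMatrix P 0 1 = cov[fun x : Fin 2 → ℝ => x 0, fun x => x 1; P] := rfl
  rw [h00, h11, h01] at hdet ⊢
  -- Cauchy–Schwarz makes the covariance determinant nonnegative, so `hdet` makes it positive, and
  -- both variances with it.
  have hcs : cov[fun x : Fin 2 → ℝ => x 0, fun x => x 1; P] ^ 2 ≤
      Var[fun x : Fin 2 → ℝ => x 0; P] * Var[fun x : Fin 2 → ℝ => x 1; P] := by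
    refine BGe.sq_le_mul_of_quadratic_nonneg fun u v => ?_
    have h := variance_nonneg (fun x : Fin 2 → ℝ => u * x 0 + v * x 1) P
    rw [variance_fun_add ((hP 0).const_mul u) ((hP 1).const_mul v), variance_const_mul,
      variance_const_mul, covariance_const_mul_left, covariance_const_mul_right] at h
    linarith
  have hD : 0 < Var[fun x : Fin 2 → ℝ => x 0; P] * Var[fun x : Fin 2 → ℝ => x 1; P] -
      cov[fun x : Fin 2 → ℝ => x 0, fun x => x 1; P] ^ 2 :=
    lt_of_le_of_ne (by linarith) hdet.symm
  have hprod : 0 < Var[fun x : Fin 2 → ℝ => x 0; P] * Var[fun x : Fin 2 → ℝ => x 1; P] := by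
    linarith [sq_nonneg cov[fun x : Fin 2 → ℝ => x 0, fun x => x 1; P]]
  have hV : 0 < Var[fun x : Fin 2 → ℝ => x 0; P] :=
    pos_of_mul_pos_left hprod (variance_nonneg _ _)
  have hU : 0 < Var[fun x : Fin 2 → ℝ => x 1; P] :=
    pos_of_mul_pos_right hprod (variance_nonneg _ _)
  obtain ⟨C, hC⟩ := BGe.exists_logPosteriorRatio_eq hαμ hαw ht hp hp_empty hp_edge
  have hC' : ∀ (N : ℕ) (x : Fin N → Fin 2 → ℝ), BGe.logPosteriorRatio αμ αw t p x = _ :=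
    fun N x => hC N x _ _ rfl rfl
  have hi0 := fun N => BGe.integrable_log_scatter (hm 0) (hP 0) hαμ ht N
  have hi1 := fun N => BGe.integrable_log_scatter (hm 1) (hP 1) hαμ ht N
  have hid := fun N => BGe.integrable_log_det (hm 0) (hm 1) (hP 0) (hP 1) hαμ ht N
  have hpair : ∀ N : ℕ, Integrable (fun x : Fin N → Fin 2 → ℝ => (αw + N - 1) / 2 *
      (Real.log (t + BGe.scatter αμ (fun k => x k 0) fun k => x k 0) +
        Real.log (t + BGe.scatter αμ (fun k => x k 1) fun k => x k 1)))
      (Measure.pi fun _ => P) := fun N => ((hi0 N).add (hi1 N)).const_mul _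
  have hsum : ∀ N : ℕ, Integrable (fun x : Fin N → Fin 2 → ℝ =>
      C + Real.log (Real.Gamma ((αw + N) / 2)) - Real.log (Real.Gamma ((αw + N - 1) / 2)) +
        (αw + N - 1) / 2 *
          (Real.log (t + BGe.scatter αμ (fun k => x k 0) fun k => x k 0) +
            Real.log (t + BGe.scatter αμ (fun k => x k 1) fun k => x k 1)))
      (Measure.pi fun _ => P) := fun N =>
    (integrable_const _).add (hpair N)
  refine ⟨fun N => ?_, ?_⟩
  · simp_rw [hC']
    exact (hsum N).sub ((hid N).const_mul _)
  have ht0 := BGe.tendsto_integral_log_scatter (hm 0) (hP 0) hαμ ht hV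
  have ht1 := BGe.tendsto_integral_log_scatter (hm 1) (hP 1) hαμ ht hU
  have htd := BGe.tendsto_integral_log_det (hm 0) (hm 1) (hP 0) (hP 1) hαμ ht hV hD
  have hinv := tendsto_inv_atTop_nhds_zero_nat (𝕜 := ℝ)
  -- The centrings add `(αw + N - 1) * log N` and subtract `(αw + N) * log N`. The balance `-log N`,
  -- divided by `N`, is the `tendsto_log_natCast_div` term.
  have hlim := ((((hinv.const_mul C).add (BGe.tendsto_log_Gamma_sub_div hαw)).sub
    BGe.tendsto_log_natCast_div).add
    ((((hinv.const_mul (αw - 1)).add_const 1).div_const 2).mul (ht0.add ht1))).sub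
    ((((hinv.const_mul αw).add_const 1).div_const 2).mul htd)
  have hgoal : 1 / 2 * Real.log (Var[fun x : Fin 2 → ℝ => x 0; P] *
      Var[fun x : Fin 2 → ℝ => x 1; P] / (Var[fun x : Fin 2 → ℝ => x 0; P] *
      Var[fun x : Fin 2 → ℝ => x 1; P] -
      cov[fun x : Fin 2 → ℝ => x 0, fun x => x 1; P] ^ 2)) =
      C * 0 + 0 - 0 + ((αw - 1) * 0 + 1) / 2 * (Real.log Var[fun x : Fin 2 → ℝ => x 0; P] +
        Real.log Var[fun x : Fin 2 → ℝ => x 1; P]) - (αw * 0 + 1) / 2 *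
        Real.log (Var[fun x : Fin 2 → ℝ => x 0; P] * Var[fun x : Fin 2 → ℝ => x 1; P] -
        cov[fun x : Fin 2 → ℝ => x 0, fun x => x 1; P] ^ 2) := by
    rw [Real.log_div hprod.ne' hD.ne', Real.log_mul hV.ne' hU.ne']
    ring
  rw [hgoal]
  refine hlim.congr' ?_
  filter_upwards [Filter.eventually_gt_atTop 0] with N hN
  have hN' : (0 : ℝ) < N := by exact_mod_cast hN
  simp only [BGe.r10, hC']
  rw [integral_sub (hsum N) ((hid N).const_mul _),
    integral_add (integrable_const _) (hpair N), integral_const_mul,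
    integral_const_mul, integral_add (hi0 N) (hi1 N),
    integral_sub (hi0 N) (integrable_const _), integral_sub (hi1 N) (integrable_const _),
    integral_sub (hid N) (integrable_const _)]
  simp only [integral_const, probReal_univ, smul_eq_mul, one_mul]
  field_simp
  ring
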